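/- Let $H^1(-1,1)$ be the space of real functions $g\in L^2(-1,1)$ that have a weak derivative $g'\in L^1_{\mathrm{loc}}(-1,1)$ with $\int_{-1}^1(1-x^2)|g'(x)|^2\,dx<\infty$. Then $\int_{-1}^1 e^{2g(x)}\,dx<\infty$ for every $g\in H^1(-1,1)$, so that for every $\alpha\in\mathbb R$ the functional $$I_\alpha(g)=\frac{\alpha}{2}\int_{-1}^1(1-x^2)|g'(x)|^2\,dx+\int_{-1}^1 g(x)\,dx-\ln\Big(\frac12\int_{-1}^1e^{2g(x)}\,dx\Big)$$ is well defined and real-valued on $H^1(-1,1)$. Put $$\mathcal G=\Big\{g\in H^1(-1,1):\ \int_{-1}^1e^{2g(x)}\,x\,dx=0\Big\}.$$ Then $$\inf_{g\in\mathcal G}I_\alpha(g)=0\quad\text{if }\alpha\ge\tfrac12,\qquad\text{and}\qquad \inf_{g\in\mathcal G}I_\alpha(g)=-\infty\quad\text{if }\alpha<\tfrac12.$$ -/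

import Mathlib

open MeasureTheory Set
open scoped ContDiff

namespace LogSobolevLine

/-- The open interval `(-1, 1)`. -/
abbrev J : Set ℝ := Ioo (-1 : ℝ) 1

/-- `v` is a weak (distributional) derivative of `g` on `(-1, 1)`: both functions are locally
integrable on `(-1, 1)`, and `∫ g φ' = - ∫ v φ` for all `φ ∈ C_c^∞(-1, 1)`. -/
def HasWeakDeriv (g v : ℝ → ℝ) : Prop :=
  LocallyIntegrableOn g J ∧ LocallyIntegrableOn v J ∧
    ∀ φ : ℝ → ℝ, ContDiff ℝ ∞ φ → HasCompactSupport φ → tsupport φ ⊆ J →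
      ∫ x in J, g x * deriv φ x = - ∫ x in J, v x * φ x

/-- The weak derivative is unique up to equality almost everywhere on `(-1, 1)`. -/
theorem HasWeakDeriv.ae_eq {g v w : ℝ → ℝ} (hv : HasWeakDeriv g v) (hw : HasWeakDeriv g w) :
    v =ᵐ[volume.restrict J] w := by
  have key : ∀ᵐ x ∂(volume : Measure ℝ), x ∈ J → (v - w) x = 0 := by
    refine isOpen_Ioo.ae_eq_zero_of_integral_contDiff_smul_eq_zero (hv.2.1.sub hw.2.1) ?_
    intro φ hφ hc hs
    have hint : ∀ u : ℝ → ℝ, LocallyIntegrableOn u J → Integrable (fun x => u x * φ x) := by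
      intro u hu
      have h1 : IntegrableOn (fun x => u x * φ x) (tsupport φ) :=
        (hu.integrableOn_compact_subset hs hc).mul_continuousOn hφ.continuous.continuousOn hc
      refine (integrableOn_iff_integrable_of_support_subset ?_).1 h1
      intro x hx
      refine subset_tsupport φ ?_
      intro h0
      exact hx (by simp [h0])
    have hset : ∀ u : ℝ → ℝ, ∫ x in J, u x * φ x = ∫ x, u x * φ x := by
      intro u
      refine setIntegral_eq_integral_of_forall_compl_eq_zero ?_
      intro x hx
      rw [image_eq_zero_of_notMem_tsupport (fun h => hx (hs h)), mul_zero]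
    have h1 := hv.2.2 φ hφ hc hs
    have h2 := hw.2.2 φ hφ hc hs
    rw [hset v] at h1
    rw [hset w] at h2
    have : ∫ x, φ x • (v - w) x = (∫ x, v x * φ x) - ∫ x, w x * φ x := by
      rw [← integral_sub (hint v hv.2.1) (hint w hw.2.1)]
      congr 1
      ext x
      simp only [Pi.sub_apply, smul_eq_mul]
      ring
    rw [this]
    linarith
  rw [Filter.EventuallyEq, ae_restrict_iff' measurableSet_Ioo]
  filter_upwards [key] with x hx hxJ
  have := hx hxJ
  simp only [Pi.sub_apply] at this
  linarith

open Classical in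
/-- The weak derivative `g'` of `g` on `(-1, 1)` (a representative of it; zero if `g` has none). -/
noncomputable def weakDeriv (g : ℝ → ℝ) : ℝ → ℝ :=
  if h : ∃ v, HasWeakDeriv g v then h.choose else 0

theorem HasWeakDeriv.weakDeriv {g v : ℝ → ℝ} (h : HasWeakDeriv g v) :
    HasWeakDeriv g (weakDeriv g) := by
  have h' : ∃ v, HasWeakDeriv g v := ⟨v, h⟩
  rw [LogSobolevLine.weakDeriv, dif_pos h']
  exact h'.choose_spec

/-- The weighted Sobolev space `H¹(-1, 1)`: the functions `g ∈ L²(-1, 1)` that have a weak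
derivative `g'` on `(-1, 1)` with `∫ (1 - x²) |g'|² < ∞`. -/
def H1 : Set (ℝ → ℝ) :=
  {g | MemLp g 2 (volume.restrict J) ∧ HasWeakDeriv g (weakDeriv g) ∧
    IntegrableOn (fun x => (1 - x ^ 2) * |weakDeriv g x| ^ 2) J}

/-- The functional `I_α`. -/
noncomputable def functional (α : ℝ) (g : ℝ → ℝ) : ℝ :=
  α / 2 * (∫ x in J, (1 - x ^ 2) * |weakDeriv g x| ^ 2) + (∫ x in J, g x)
    - Real.log (1 / 2 * ∫ x in J, Real.exp (2 * g x))

/-- The constraint set `𝒢` of all `g ∈ H¹(-1, 1)` with `∫ e^{2 g(x)} x dx = 0`. -/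
def constraintSet : Set (ℝ → ℝ) :=
  {g | g ∈ H1 ∧ ∫ x in J, Real.exp (2 * g x) * x = 0}

end LogSobolevLine

namespace LogSobolevLine

open Filter Topology Real

/-! ### The pointwise inequality -/

/-! The energy is nonnegative, so the functional increases with `α`, and it vanishes at `0`; for `α
≥ 1/2` it remains to show nonnegativity at `α = 1/2`. Shift `g` to `k` with `∫ e^{2k} = 2`, put `u =
e^{2k}`, and let `y` be the primitive of `u` running from `-1` to `1`, with zero (median) `m`. The
claim becomes `∫ (½(1-x²)k'² + 2k) ≥ 0`. Young's inequality against `x - y` and integration by parts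
of `k(x-y)` reduce it to the dual statement that `∫ (u log u - 2(x-y)²/(1-x²)) ≥ 0` when `∫ x u =
0`.

The dual statement is proved by calibration. After adding the multiplier term `c x u` with `c =
log(1+m) - log(1-m)`, the integrand is bounded below pointwise (`entropy_pointwise`) by the total
derivative of an explicit potential along `(x, y(x))`. The model curve is the Möbius map `y =
(x-m)/(1-mx)`, which fixes `±1` and has the same median. The potential lives on `y > 0`, so `(m,1)`
is treated directly (`integral_ge_of_hasDerivAt`) and `(-1,m)` by reflection. The two boundary terms
at `m` are opposite and cancel (`integral_nonneg_of_median`). Boundary terms at `±1` vanish because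
finite energy permits only logarithmic growth of `k` with a small coefficient (`exists_abs_le_log`).

For `α < 1/2`, the even functions `-log(1-b²x²)` concentrate at both endpoints as `b → 1`. Their
energy is at most `-4 log(1-b) + O(1)` and the logarithmic term is at least `-log(1-b) - O(1)`, so
the functional is at most `(1-2α) log(1-b) + O(1)`. -/

theorem two_mul_log_one_sub_mul_ge {m x : ℝ} (hm : m ∈ J) (hx : x ∈ J) :
    log (1 + m) + log (1 - m) - (log (1 + m) - log (1 - m)) * x ≤ 2 * log (1 - m * x) := by
  obtain ⟨hm1, hm2⟩ := hm
  obtain ⟨hx1, hx2⟩ := hx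
  -- Concavity of `log`: `1 - m x` is the mean of `1 - m` and `1 + m` with weights `(1+x)/2` and
  -- `(1-x)/2`.
  have h := (strictConcaveOn_log_Ioi.concaveOn).2 (show 1 - m ∈ Ioi (0 : ℝ) from sub_pos.2 hm2)
    (show 1 + m ∈ Ioi (0 : ℝ) by simp only [mem_Ioi]; linarith)
    (show 0 ≤ (1 + x) / 2 by linarith) (show 0 ≤ (1 - x) / 2 by linarith) (by ring)
  simp only [smul_eq_mul] at h
  have e : (1 + x) / 2 * (1 - m) + (1 - x) / 2 * (1 + m) = 1 - m * x := by ring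
  rw [e] at h
  linarith

theorem one_sub_mul_pos {m x : ℝ} (hm : m ∈ J) (hx : x ∈ J) : 0 < 1 - m * x := by
  obtain ⟨hm1, hm2⟩ := hm
  obtain ⟨hx1, hx2⟩ := hx
  nlinarith [mul_pos (sub_pos.2 hm2) (show 0 < 1 + x by linarith),
    mul_pos (show 0 < 1 + m by linarith) (sub_pos.2 hx2)]

theorem mul_log_sub_ge {u w : ℝ} (hu : 0 < u) (hw : 0 < w) :
    0 ≤ u * (log u - log w - 1) + w := by
  have h := log_le_sub_one_of_pos (div_pos hw hu)
  rw [log_div hw.ne' hu.ne'] at h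
  have h2 := mul_le_mul_of_nonneg_left h hu.le
  have e : u * (w / u - 1) = w - u := by field_simp
  linarith

/-- Three nonnegative quantities add up to the difference of the two sides: the tangent-line gap of
`u log u` at a slope `w`, and `u` times the gaps in `log t ≤ t - 1` and in the concavity bound for
`log (1 - m x)`. The terms `log (1 - m x)` cancel in the sum, and what remains on the left is an
exact derivative. The first two gaps vanish on the Möbius curve. -/
theorem entropy_pointwise {m x y u : ℝ} (hm : m ∈ J) (hx : x ∈ Ioo m 1) (hy : y ∈ Ioo (0 : ℝ) 1)
    (hu : 0 < u) :
    2 - 2 * y * (1 - m * y) / (x - m + y * (1 - m * x)) - (1 - y) / (1 - x) - (1 + y) / (1 + x)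
      + u * (-2 * log (x - m + y * (1 - m * x))
        - 2 * y * (1 - m * x) / (x - m + y * (1 - m * x))
        - log (1 - x) + log (1 - y) - log (1 + x) + log (1 + y) + log (1 + m) + log (1 - m)
        + 2 * log (2 * y) + 2)
      ≤ u * log u - 2 * (x - y) ^ 2 / (1 - x ^ 2) + (log (1 + m) - log (1 - m)) * (x * u) := by
  obtain ⟨hm1, hm2⟩ := hm
  obtain ⟨hx1, hx2⟩ := hx
  obtain ⟨hy1, hy2⟩ := hy
  have hr : 0 < 1 - m * x := one_sub_mul_pos ⟨hm1, hm2⟩ ⟨by linarith, hx2⟩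
  have hz : 0 < x - m + y * (1 - m * x) := by nlinarith [mul_pos hy1 hr]
  have hc := two_mul_log_one_sub_mul_ge ⟨hm1, hm2⟩ (x := x) ⟨by linarith, hx2⟩
  set r := 1 - m * x with hr'
  set z := x - m + y * r with hz'
  have hx3 : 0 < 1 - x := by linarith
  have hx4 : 0 < 1 + x := by linarith
  have hy3 : 0 < 1 - y := by linarith
  have hy4 : 0 < 1 + y := by linarith
  -- The tangency slope `w`. On `y = (x-m)/(1-mx)` one has `z = 2yr`, so `w` equals `(1-y²)/(1-x²)`,
  -- the slope of that curve.
  have hw : 0 < 2 * y * ((1 - y) * (1 + y)) * r / (z * ((1 - x) * (1 + x))) := by positivity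
  have h1 := mul_log_sub_ge hu hw
  have hlogw : log (2 * y * ((1 - y) * (1 + y)) * r / (z * ((1 - x) * (1 + x)))) =
      log (2 * y) + (log (1 - y) + log (1 + y)) + log r - (log z + (log (1 - x) + log (1 + x))) := by
    rw [log_div (by positivity) (by positivity), log_mul (by positivity) hr.ne',
      log_mul (by positivity) (by positivity), log_mul hy3.ne' hy4.ne',
      log_mul hz.ne' (by positivity), log_mul hx3.ne' hx4.ne']
  rw [hlogw] at h1
  have h2 : 0 ≤ log z - log (2 * y) - log r + 2 * y * r / z - 1 := by
    have := log_le_sub_one_of_pos (show 0 < 2 * y * r / z by positivity)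
    rw [log_div (by positivity) hz.ne', log_mul (by positivity) hr.ne'] at this
    linarith
  have h2' := mul_nonneg hu.le h2
  have hc' := mul_nonneg hu.le (sub_nonneg.2 hc)
  -- Partial fractions: the part free of `u` is `-w` minus the quadratic term.
  have e : 2 - 2 * y * (1 - m * y) / z - (1 - y) / (1 - x) - (1 + y) / (1 + x)
      = - (2 * y * ((1 - y) * (1 + y)) * r / (z * ((1 - x) * (1 + x))))
        - 2 * (x - y) ^ 2 / (1 - x ^ 2) := by
    have h3 : (1 - x ^ 2) ≠ 0 := by nlinarith [mul_pos hx3 hx4]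
    have h4 : 1 - x ^ 2 = (1 - x) * (1 + x) := by ring
    rw [h4]
    field_simp
    rw [hz', hr']
    ring
  rw [e]
  nlinarith [h1, h2', hc']

/-! ### Primitives -/

/-- `f` is a primitive on `[a, b]` of the integrable function `f'`. -/
def IsPrimitiveOn (f f' : ℝ → ℝ) (a b : ℝ) : Prop :=
  IntervalIntegrable f' volume a b ∧ ∀ x ∈ uIcc a b, f x = f a + ∫ t in a..x, f' t

theorem IsPrimitiveOn.absolutelyContinuousOnInterval {f f' : ℝ → ℝ} {a b : ℝ}
    (h : IsPrimitiveOn f f' a b) :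
    AbsolutelyContinuousOnInterval (fun x => f a + ∫ t in a..x, f' t) a b := by
  refine AbsolutelyContinuousOnInterval.fun_add ?_
    (h.1.absolutelyContinuousOnInterval_intervalIntegral left_mem_uIcc)
  exact contDiffOn_const.absolutelyContinuousOnInterval

theorem IsPrimitiveOn.integral_by_parts {f f' g g' : ℝ → ℝ} {a b : ℝ}
    (hf : IsPrimitiveOn f f' a b) (hg : IsPrimitiveOn g g' a b) :
    ∫ x in a..b, (f' x * g x + f x * g' x) = f b * g b - f a * g a := by
  have h := hf.absolutelyContinuousOnInterval.integral_deriv_mul_eq_sub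
    hg.absolutelyContinuousOnInterval
  rw [← hf.2 b right_mem_uIcc, ← hg.2 b right_mem_uIcc, ← hf.2 a left_mem_uIcc,
    ← hg.2 a left_mem_uIcc] at h
  rw [← h]
  refine intervalIntegral.integral_congr_ae ?_
  filter_upwards [hf.1.ae_hasDerivAt_integral, hg.1.ae_hasDerivAt_integral] with x h1 h2 hx
  have hx' := uIoc_subset_uIcc hx
  rw [((h1 hx' a left_mem_uIcc).const_add (f a)).deriv,
    ((h2 hx' a left_mem_uIcc).const_add (g a)).deriv, ← hf.2 x hx', ← hg.2 x hx']

theorem IsPrimitiveOn.continuousOn {f f' : ℝ → ℝ} {a b : ℝ} (h : IsPrimitiveOn f f' a b) :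
    ContinuousOn f (uIcc a b) :=
  h.absolutelyContinuousOnInterval.continuousOn.congr fun x hx => h.2 x hx

theorem isPrimitiveOn_of_hasDerivAt {f f' : ℝ → ℝ} {a b : ℝ}
    (h : ∀ x ∈ uIcc a b, HasDerivAt f (f' x) x) (hc : ContinuousOn f' (uIcc a b)) :
    IsPrimitiveOn f f' a b := by
  refine ⟨hc.intervalIntegrable, fun x hx => ?_⟩
  have hs : uIcc a x ⊆ uIcc a b := uIcc_subset_uIcc_left hx
  rw [intervalIntegral.integral_eq_sub_of_hasDerivAt (fun t ht => h t (hs ht))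
    (hc.mono hs).intervalIntegrable]
  ring

/-! ### The inequality on one side of the median -/

/-- A potential whose increments along the curve `(x, y x)` bound the entropy from below. -/
noncomputable def entropyPotential (m x y : ℝ) : ℝ :=
  2 * x - 2 * (y * log (x - m + y * (1 - m * x))) + (1 - y) * log (1 - x) - (1 - y) * log (1 - y)
    - (1 + y) * log (1 + x) + (1 + y) * log (1 + y) - (1 - y) * log (1 + m) + (1 + y) * log (1 - m)
    + 2 * y * log (2 * y) - 2 * y

/-- The derivative of `entropyPotential` along a curve `(x, y x)` with `y' = u`. -/
noncomputable def entropyPotentialDeriv (m x y u : ℝ) : ℝ :=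
  2 - 2 * y * (1 - m * y) / (x - m + y * (1 - m * x)) - (1 - y) / (1 - x) - (1 + y) / (1 + x)
    + u * (-2 * log (x - m + y * (1 - m * x))
      - 2 * y * (1 - m * x) / (x - m + y * (1 - m * x))
      - log (1 - x) + log (1 - y) - log (1 + x) + log (1 + y) + log (1 + m) + log (1 - m)
      + 2 * log (2 * y) + 2)

theorem add_mul_pos {m x y : ℝ} (hm : m ∈ J) (hx : x ∈ Ioo m 1) (hy : 0 < y) :
    0 < x - m + y * (1 - m * x) :=
  add_pos (sub_pos.2 hx.1) (mul_pos hy (one_sub_mul_pos hm ⟨hm.1.trans hx.1, hx.2⟩))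

theorem hasDerivAt_entropyPotential {m x u : ℝ} {y : ℝ → ℝ} (hm : m ∈ J) (hx : x ∈ Ioo m 1)
    (hy : y x ∈ Ioo (0 : ℝ) 1) (hd : HasDerivAt y u x) :
    HasDerivAt (fun x => entropyPotential m x (y x)) (entropyPotentialDeriv m x (y x) u) x := by
  have hz := (add_mul_pos hm hx hy.1).ne'
  have hx1 : 1 - x ≠ 0 := (sub_pos.2 hx.2).ne'
  have hx2 : 1 + x ≠ 0 := by have := hm.1; have := hx.1; intro h; linarith
  have hy0 := hy.1
  have hy1 : 1 - y x ≠ 0 := (sub_pos.2 hy.2).ne'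
  have hy2 : 1 + y x ≠ 0 := by positivity
  have hy3 : 2 * y x ≠ 0 := by positivity
  have i := hasDerivAt_id' x
  have d := (((((((((i.const_mul 2).sub ((hd.mul (((i.sub_const m).add
    (hd.mul ((i.const_mul m).const_sub 1))).log hz)).const_mul 2)).add
    ((hd.const_sub 1).mul ((i.const_sub 1).log hx1))).sub
    ((hd.const_sub 1).mul ((hd.const_sub 1).log hy1))).sub
    ((hd.const_add 1).mul ((i.const_add 1).log hx2))).add
    ((hd.const_add 1).mul ((hd.const_add 1).log hy2))).sub
    ((hd.const_sub 1).mul_const (log (1 + m)))).add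
    ((hd.const_add 1).mul_const (log (1 - m)))).add
    ((hd.const_mul 2).mul ((hd.const_mul 2).log hy3))).sub (hd.const_mul 2)
  refine HasDerivAt.congr_deriv (f := fun x => entropyPotential m x (y x)) d ?_
  simp only [entropyPotentialDeriv, Pi.mul_apply, Pi.add_apply]
  field_simp
  ring

theorem continuousOn_entropyPotentialDeriv {m : ℝ} {y u : ℝ → ℝ} {s : Set ℝ} (hm : m ∈ J)
    (hs : s ⊆ Ioo m 1) (hy : ∀ x ∈ s, y x ∈ Ioo (0 : ℝ) 1) (hyc : ContinuousOn y s)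
    (huc : ContinuousOn u s) :
    ContinuousOn (fun x => entropyPotentialDeriv m x (y x) (u x)) s := by
  have hz : ∀ x ∈ s, x - m + y x * (1 - m * x) ≠ 0 := fun x hx =>
    (add_mul_pos hm (hs hx) (hy x hx).1).ne'
  have hx1 : ∀ x ∈ s, 1 - x ≠ 0 := fun x hx => (sub_pos.2 (hs hx).2).ne'
  have hx2 : ∀ x ∈ s, 1 + x ≠ 0 := fun x hx h => by
    have := hm.1; have := (hs hx).1; linarith
  have hy1 : ∀ x ∈ s, 1 - y x ≠ 0 := fun x hx => (sub_pos.2 (hy x hx).2).ne'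
  have hy2 : ∀ x ∈ s, 1 + y x ≠ 0 := fun x hx => by have := (hy x hx).1; positivity
  have hy3 : ∀ x ∈ s, 2 * y x ≠ 0 := fun x hx => by have := (hy x hx).1; positivity
  unfold entropyPotentialDeriv
  fun_prop (disch := assumption)

theorem tendsto_mul_log_zero {f : ℝ → ℝ} {l : Filter ℝ} (h : Tendsto f l (𝓝 0)) :
    Tendsto (fun x => f x * log (f x)) l (𝓝 0) := by
  have := (continuous_mul_log.tendsto 0).comp h
  rw [zero_mul] at this
  exact this

/-- The delicate term is `y log z` with `z = x - m + y (1 - m x)`. Since `y (1 - m x) ≤ z`, it is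
dominated by `|z log z| / (1 - m x)`, which tends to `0`. -/
theorem tendsto_entropyPotential_left {m : ℝ} {y : ℝ → ℝ} (hm : m ∈ J)
    (hy : ∀ x ∈ Ioo m 1, y x ∈ Ioo (0 : ℝ) 1) (h0 : Tendsto y (𝓝[>] m) (𝓝 0)) :
    Tendsto (fun x => entropyPotential m x (y x)) (𝓝[>] m)
      (𝓝 (2 * m - 2 * (log (1 + m) - log (1 - m)))) := by
  have hx : Tendsto (fun x : ℝ => x) (𝓝[>] m) (𝓝 m) := nhdsWithin_le_nhds
  have hr : Tendsto (fun x => 1 - m * x) (𝓝[>] m) (𝓝 (1 - m * m)) := (hx.const_mul m).const_sub 1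
  have hr0 : 1 - m * m ≠ 0 := (one_sub_mul_pos hm hm).ne'
  have hz : Tendsto (fun x => x - m + y x * (1 - m * x)) (𝓝[>] m) (𝓝 0) := by
    have := (hx.sub_const m).add (h0.mul hr)
    simpa using this
  have h1 : Tendsto (fun x => y x * log (x - m + y x * (1 - m * x))) (𝓝[>] m) (𝓝 0) := by
    have h2 := (((tendsto_mul_log_zero hz).mul (hr.inv₀ hr0)).norm)
    simp only [zero_mul, norm_zero] at h2
    refine squeeze_zero_norm' ?_ h2
    filter_upwards [Ioo_mem_nhdsGT hm.2] with x hx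
    have hr1 := one_sub_mul_pos hm ⟨hm.1.trans hx.1, hx.2⟩
    have hyx := (hy x hx).1
    have hz1 := add_mul_pos hm hx hyx
    rw [norm_mul, norm_mul, norm_mul, norm_inv, norm_of_nonneg hyx.le, norm_of_nonneg hz1.le,
      norm_of_nonneg hr1.le, mul_right_comm]
    refine mul_le_mul_of_nonneg_right ?_ (norm_nonneg _)
    rw [← div_eq_mul_inv, le_div_iff₀ hr1]
    linarith [hx.1]
  have hm1 : 1 - m ≠ 0 := (sub_pos.2 hm.2).ne'
  have hm2 : 1 + m ≠ 0 := by have := hm.1; intro h; linarith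
  have h3 := (tendsto_mul_log_zero (show Tendsto (fun x => 2 * y x) (𝓝[>] m) (𝓝 0) by
    simpa using h0.const_mul 2))
  have ha := h0.const_sub 1
  have hb := h0.const_add 1
  have d := (((((((((hx.const_mul 2).sub (h1.const_mul 2)).add
    (ha.mul ((hx.const_sub 1).log hm1))).sub
    (ha.mul (ha.log (by norm_num)))).sub
    (hb.mul ((hx.const_add 1).log hm2))).add
    (hb.mul (hb.log (by norm_num)))).sub
    (ha.mul_const (log (1 + m)))).add
    (hb.mul_const (log (1 - m)))).add h3).sub (h0.const_mul 2)
  refine (d.congr fun x => ?_).trans (le_of_eq ?_)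
  · simp only [entropyPotential]
  · congr 1
    simp only [sub_zero, add_zero, log_one]
    ring

theorem tendsto_entropyPotential_right {m : ℝ} {y : ℝ → ℝ} (hm : m ∈ J)
    (h1 : Tendsto y (𝓝[<] 1) (𝓝 1))
    (hlog : Tendsto (fun x => (1 - y x) * log (1 - x)) (𝓝[<] 1) (𝓝 0)) :
    Tendsto (fun x => entropyPotential m x (y x)) (𝓝[<] 1) (𝓝 0) := by
  have hx : Tendsto (fun x : ℝ => x) (𝓝[<] 1) (𝓝 1) := nhdsWithin_le_nhds
  have hm1 : 0 < 1 - m := sub_pos.2 hm.2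
  have hz : Tendsto (fun x => x - m + y x * (1 - m * x)) (𝓝[<] 1) (𝓝 (2 * (1 - m))) := by
    have := (hx.sub_const m).add (h1.mul ((hx.const_mul m).const_sub 1))
    convert this using 2
    ring
  have ha : Tendsto (fun x => 1 - y x) (𝓝[<] 1) (𝓝 0) := by simpa using h1.const_sub 1
  have hb := h1.const_add 1
  have hc := h1.const_mul 2
  have d := (((((((((hx.const_mul 2).sub ((h1.mul (hz.log (by positivity))).const_mul 2)).add
    hlog).sub
    (tendsto_mul_log_zero ha)).sub
    (hb.mul ((hx.const_add 1).log (by norm_num)))).add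
    (hb.mul (hb.log (by norm_num)))).sub
    (ha.mul_const (log (1 + m)))).add
    (hb.mul_const (log (1 - m)))).add (hc.mul (hc.log (by norm_num)))).sub hc
  refine (d.congr fun x => ?_).trans (le_of_eq ?_)
  · simp only [entropyPotential]
  · congr 1
    rw [log_mul (by norm_num) hm1.ne']
    norm_num
    ring

/-- With `u = e^{2k}` one has `u log u = 2ku`, which the term `2k(1-u)` turns into `2k`. The rest is
Young's inequality for `2v(x-y)` with weight `1 - x²`, by completing a square. The first summand on
the left is the derivative of `2k(x-y)`. -/
theorem energy_pointwise {m x y k v : ℝ} (hm : m ∈ J) (hx : x ∈ Ioo m 1) (hy : y ∈ Ioo (0 : ℝ) 1) :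
    2 * (v * (x - y) + k * (1 - exp (2 * k))) + entropyPotentialDeriv m x y (exp (2 * k))
      ≤ 1 / 2 * ((1 - x ^ 2) * |v| ^ 2) + 2 * k
        + (log (1 + m) - log (1 - m)) * (x * exp (2 * k)) := by
  have h := entropy_pointwise hm hx hy (exp_pos (2 * k))
  rw [log_exp] at h
  have hq : 0 < 1 - x ^ 2 := by nlinarith [hm.1, hx.1, hx.2]
  have h2 : 2 * (v * (x - y)) ≤ 1 / 2 * ((1 - x ^ 2) * |v| ^ 2) + 2 * (x - y) ^ 2 / (1 - x ^ 2) := by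
    rw [sq_abs, ← sub_nonneg]
    have : 1 / 2 * ((1 - x ^ 2) * v ^ 2) + 2 * (x - y) ^ 2 / (1 - x ^ 2) - 2 * (v * (x - y))
      = ((1 - x ^ 2) * v - 2 * (x - y)) ^ 2 / (2 * (1 - x ^ 2)) := by
      field_simp
      ring
    rw [this]
    positivity
  unfold entropyPotentialDeriv
  linarith

theorem mem_Ioo_of_hasDerivAt {m : ℝ} {y u : ℝ → ℝ} (hm : m ∈ J)
    (hy : ∀ x ∈ J, HasDerivAt y (u x) x) (hu : ∀ x ∈ J, 0 < u x) (hym : y m = 0)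
    (h1 : Tendsto y (𝓝[<] 1) (𝓝 1)) : ∀ x ∈ Ioo m 1, y x ∈ Ioo (0 : ℝ) 1 := by
  have hmono : StrictMonoOn y J := by
    refine strictMonoOn_of_deriv_pos (convex_Ioo _ _)
      (fun x hx => (hy x hx).continuousAt.continuousWithinAt) fun x hx => ?_
    rw [interior_Ioo] at hx
    rw [(hy x hx).deriv]
    exact hu x hx
  intro x hx
  have hxJ : x ∈ J := ⟨hm.1.trans hx.1, hx.2⟩
  refine ⟨hym ▸ hmono hm hxJ hx.1, ?_⟩
  obtain ⟨z, hz1, hz2⟩ := exists_between hx.2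
  have hzJ : z ∈ J := ⟨hxJ.1.trans hz1, hz2⟩
  refine (hmono hxJ hzJ hz1).trans_le (ge_of_tendsto h1 ?_)
  filter_upwards [Ioo_mem_nhdsLT hz2] with w hw
  exact (hmono hzJ ⟨hzJ.1.trans hw.1, hw.2⟩ hw.1).le

/-- The pointwise bound is integrated over `[a, b]` inside `(m, 1)`, where the potential is smooth;
then `b → 1`, which contributes nothing, and `a → m`. The resulting bound is odd under `x ↦ -x`, `m
↦ -m`, so the mirrored half will cancel it. -/
theorem integral_ge_of_hasDerivAt {m : ℝ} {k v y : ℝ → ℝ} (hm : m ∈ J)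
    (hk : ∀ a ∈ J, ∀ b ∈ J, IsPrimitiveOn k v a b)
    (hy : ∀ x ∈ J, HasDerivAt y (exp (2 * k x)) x) (hym : y m = 0)
    (h1 : Tendsto y (𝓝[<] 1) (𝓝 1))
    (hlog : Tendsto (fun x => (1 - y x) * log (1 - x)) (𝓝[<] 1) (𝓝 0))
    (hkh : Tendsto (fun x => k x * (x - y x)) (𝓝[<] 1) (𝓝 0))
    (hint : IntegrableOn (fun x => 1 / 2 * ((1 - x ^ 2) * |v x| ^ 2) + 2 * k x
      + (log (1 + m) - log (1 - m)) * (x * exp (2 * k x))) (Ioo m 1)) :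
    -2 * (k m * m) - (2 * m - 2 * (log (1 + m) - log (1 - m))) ≤
      ∫ x in Ioo m 1, (1 / 2 * ((1 - x ^ 2) * |v x| ^ 2) + 2 * k x
        + (log (1 + m) - log (1 - m)) * (x * exp (2 * k x))) := by
  set F := fun x => 1 / 2 * ((1 - x ^ 2) * |v x| ^ 2) + 2 * k x
      + (log (1 + m) - log (1 - m)) * (x * exp (2 * k x)) with hF
  have hsub : Ioo m 1 ⊆ J := fun x hx => ⟨hm.1.trans hx.1, hx.2⟩
  have hyI := mem_Ioo_of_hasDerivAt hm hy (fun x _ => exp_pos _) hym h1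
  have key : ∀ a ∈ Ioo m 1, ∀ b ∈ Ioo m 1, a ≤ b →
      2 * (k b * (b - y b)) + entropyPotential m b (y b)
        - (2 * (k a * (a - y a)) + entropyPotential m a (y a)) ≤ ∫ x in a..b, F x := by
    intro a ha b hb hab
    have hs : Icc a b ⊆ Ioo m 1 := Icc_subset_Ioo ha.1 hb.2
    have hs' : uIcc a b ⊆ Ioo m 1 := by rwa [uIcc_of_le hab]
    have hkab := hk a (hsub ha) b (hsub hb)
    have hkc := hkab.continuousOn
    have hyc : ContinuousOn y (uIcc a b) := fun x hx =>
      (hy x (hsub (hs' hx))).continuousAt.continuousWithinAt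
    have huc : ContinuousOn (fun x => exp (2 * k x)) (uIcc a b) := by fun_prop
    have hh : IsPrimitiveOn (fun x => x - y x) (fun x => 1 - exp (2 * k x)) a b :=
      isPrimitiveOn_of_hasDerivAt (fun x hx => (hasDerivAt_id' x).sub (hy x (hsub (hs' hx))))
        (by fun_prop)
    have hW : IsPrimitiveOn (fun x => entropyPotential m x (y x))
        (fun x => entropyPotentialDeriv m x (y x) (exp (2 * k x))) a b :=
      isPrimitiveOn_of_hasDerivAt
        (fun x hx => hasDerivAt_entropyPotential hm (hs' hx) (hyI x (hs' hx)) (hy x (hsub (hs' hx))))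
        (continuousOn_entropyPotentialDeriv hm hs' (fun x hx => hyI x (hs' hx)) hyc huc)
    have hi1 : IntervalIntegrable (fun x => v x * (x - y x) + k x * (1 - exp (2 * k x)))
        volume a b :=
      (hkab.1.mul_continuousOn hh.continuousOn).add (hh.1.continuousOn_mul hkc)
    have e1 := hkab.integral_by_parts hh
    have e2 := hW.2 b right_mem_uIcc
    have e3 : ∫ x in a..b, (2 * (v x * (x - y x) + k x * (1 - exp (2 * k x)))
        + entropyPotentialDeriv m x (y x) (exp (2 * k x))) =
        2 * (k b * (b - y b)) + entropyPotential m b (y b)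
        - (2 * (k a * (a - y a)) + entropyPotential m a (y a)) := by
      rw [intervalIntegral.integral_add (hi1.const_mul 2) hW.1, intervalIntegral.integral_const_mul,
        e1]
      simp only at e2
      linarith
    rw [← e3]
    refine intervalIntegral.integral_mono_on hab ((hi1.const_mul 2).add hW.1)
      ((intervalIntegrable_iff_integrableOn_Icc_of_le hab).2 (hint.mono_set hs)) fun x hx => ?_
    exact energy_pointwise hm (hs hx) (hyI x (hs hx))
  have hII : IntegrableOn F (Icc m 1) := by rwa [integrableOn_Icc_iff_integrableOn_Ioo]
  have hII' : IntervalIntegrable F volume m 1 :=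
    (intervalIntegrable_iff_integrableOn_Icc_of_le hm.2.le).2 hII
  have hcont : ContinuousOn (fun x => ∫ t in m..x, F t) (Icc m 1) := by
    have := intervalIntegral.continuousOn_primitive_interval' hII' left_mem_uIcc
    rwa [uIcc_of_le hm.2.le] at this
  have htr : Tendsto (fun x => ∫ t in m..x, F t) (𝓝[<] 1) (𝓝 (∫ t in m..1, F t)) := by
    have := (hcont 1 (right_mem_Icc.2 hm.2.le)).tendsto
    exact this.mono_left (nhdsWithin_le_of_mem (Icc_mem_nhdsLT hm.2))
  have htl : Tendsto (fun x => ∫ t in m..x, F t) (𝓝[>] m) (𝓝 (∫ t in m..m, F t)) := by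
    have := (hcont m (left_mem_Icc.2 hm.2.le)).tendsto
    exact this.mono_left (nhdsWithin_le_of_mem (Icc_mem_nhdsGT hm.2))
  rw [intervalIntegral.integral_same] at htl
  have hkm : Tendsto k (𝓝[>] m) (𝓝 (k m)) := by
    obtain ⟨b, hb1, hb2⟩ := exists_between hm.2
    have hc := (hk m hm b ⟨hm.1.trans hb1, hb2⟩).continuousOn m left_mem_uIcc
    rw [uIcc_of_le hb1.le] at hc
    exact hc.tendsto.mono_left (nhdsWithin_le_of_mem (Icc_mem_nhdsGT hb1))
  have hym' : Tendsto y (𝓝[>] m) (𝓝 0) := by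
    have := (hy m hm).continuousAt.tendsto
    rw [hym] at this
    exact this.mono_left nhdsWithin_le_nhds
  have hxm : Tendsto (fun x : ℝ => x) (𝓝[>] m) (𝓝 m) := nhdsWithin_le_nhds
  have hsplit : ∀ a ∈ Ioo m 1, ∀ b ∈ Ioo m 1,
      ∫ x in a..b, F x = (∫ x in m..b, F x) - ∫ x in m..a, F x := by
    have hi : ∀ a ∈ Ioo m 1, IntervalIntegrable F volume m a := fun a ha =>
      hII'.mono_set (by rw [uIcc_of_le ha.1.le, uIcc_of_le hm.2.le]; exact Icc_subset_Icc_right ha.2.le)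
    intro a ha b hb
    rw [intervalIntegral.integral_interval_sub_left (hi b hb) (hi a ha)]
  have step : ∀ a ∈ Ioo m 1, 0 - (2 * (k a * (a - y a)) + entropyPotential m a (y a)) ≤
      (∫ x in m..1, F x) - ∫ x in m..a, F x := by
    intro a ha
    have hl := ((hkh.const_mul 2).add (tendsto_entropyPotential_right hm h1 hlog)).sub_const
      (2 * (k a * (a - y a)) + entropyPotential m a (y a))
    rw [mul_zero, add_zero] at hl
    refine le_of_tendsto_of_tendsto hl (htr.sub_const (∫ x in m..a, F x)) ?_
    filter_upwards [Ioo_mem_nhdsLT ha.2] with b hb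
    have hb' : b ∈ Ioo m 1 := ⟨ha.1.trans hb.1, hb.2⟩
    rw [← hsplit a ha b hb']
    exact key a ha b hb' hb.1.le
  have fin := le_of_tendsto_of_tendsto
    ((((hkm.mul (hxm.sub hym')).const_mul 2).add
      (tendsto_entropyPotential_left hm hyI hym')).const_sub 0)
    (htl.const_sub (∫ x in m..1, F x))
    (by filter_upwards [Ioo_mem_nhdsGT hm.2] with a ha using step a ha)
  rw [intervalIntegral.integral_of_le hm.2.le, integral_Ioc_eq_integral_Ioo] at fin
  linarith

/-! ### Absolutely continuous representatives -/

theorem exists_tsupport_subset_Ioo {φ : ℝ → ℝ} (hc : HasCompactSupport φ) (hs : tsupport φ ⊆ J) :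
    ∃ d ∈ Ioo (0 : ℝ) 1, tsupport φ ⊆ Ioo (-d) d := by
  rcases (tsupport φ).eq_empty_or_nonempty with h | h
  · exact ⟨1 / 2, by norm_num, by simp [h]⟩
  · obtain ⟨z, hz, hmax⟩ := IsCompact.exists_isMaxOn hc h (continuous_abs.continuousOn)
    obtain ⟨d, hd1, hd2⟩ := exists_between (abs_lt.2 ⟨(hs hz).1, (hs hz).2⟩)
    refine ⟨d, ⟨(abs_nonneg z).trans_lt hd1, hd2⟩, fun x hx => ?_⟩
    have := (hmax hx).trans_lt hd1
    exact abs_lt.1 this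

theorem setIntegral_J_eq_of_support {f : ℝ → ℝ} (hf : Function.support f ⊆ J) :
    ∫ x in J, f x = ∫ x, f x :=
  setIntegral_eq_integral_of_forall_compl_eq_zero fun _ hx =>
    Function.notMem_support.1 fun h => hx (hf h)

theorem integrable_mul_test {u φ : ℝ → ℝ} (hu : LocallyIntegrableOn u J) (hφ : Continuous φ)
    (hc : HasCompactSupport φ) (hs : tsupport φ ⊆ J) : Integrable (fun x => u x * φ x) := by
  have h1 : IntegrableOn (fun x => u x * φ x) (tsupport φ) :=
    (hu.integrableOn_compact_subset hs hc).mul_continuousOn hφ.continuousOn hc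
  refine (integrableOn_iff_integrable_of_support_subset ?_).1 h1
  exact (Function.support_mul_subset_right _ _).trans (subset_tsupport φ)

theorem support_mul_test {u φ : ℝ → ℝ} (hs : tsupport φ ⊆ J) :
    Function.support (fun x => u x * φ x) ⊆ J :=
  (Function.support_mul_subset_right _ _).trans ((subset_tsupport φ).trans hs)

/-- A test function on `(-1, 1)` with vanishing integral is the derivative of a test function. -/
theorem exists_test_primitive {η : ℝ → ℝ} (hη : ContDiff ℝ ∞ η) (hc : HasCompactSupport η)
    (hs : tsupport η ⊆ J) (h0 : ∫ x, η x = 0) :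
    ∃ Φ : ℝ → ℝ, ContDiff ℝ ∞ Φ ∧ HasCompactSupport Φ ∧ tsupport Φ ⊆ J ∧ deriv Φ = η := by
  obtain ⟨d, hd, hsd⟩ := exists_tsupport_subset_Ioo hc hs
  have hz : ∀ x, x ∉ Ioo (-d) d → η x = 0 := fun x hx =>
    image_eq_zero_of_notMem_tsupport fun h => hx (hsd h)
  have hder : ∀ x, HasDerivAt (fun x => ∫ t in (-d)..x, η t) (η x) x := fun x =>
    intervalIntegral.integral_hasDerivAt_right (hη.continuous.intervalIntegrable _ _)
      (hη.continuous.stronglyMeasurableAtFilter _ _) hη.continuous.continuousAt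
  have hd' : deriv (fun x => ∫ t in (-d)..x, η t) = η := funext fun x => (hder x).deriv
  have hsupp : ∀ x, x ∉ Icc (-d) d → ∫ t in (-d)..x, η t = 0 := by
    intro x hx
    by_cases hxd : x < -d
    · rw [intervalIntegral.integral_congr (g := fun _ => 0)]
      · simp
      · intro t ht
        rw [uIcc_of_ge hxd.le] at ht
        exact hz t fun h => absurd h.1 (not_lt.2 ht.2)
    · have hx2 : d < x := by
        by_contra h
        exact hx ⟨not_lt.1 hxd, not_lt.1 h⟩
      rw [intervalIntegral.integral_eq_integral_of_support_subset, h0]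
      intro t ht
      by_contra h
      refine ht (hz t fun h' => h ⟨h'.1, (h'.2.trans hx2).le⟩)
  have hts : tsupport (fun x => ∫ t in (-d)..x, η t) ⊆ Icc (-d) d := by
    refine closure_minimal (fun x hx => ?_) isClosed_Icc
    by_contra h
    exact hx (hsupp x h)
  refine ⟨fun x => ∫ t in (-d)..x, η t, ?_, ?_, ?_, hd'⟩
  · rw [contDiff_infty_iff_deriv, hd']
    exact ⟨fun x => (hder x).differentiableAt, hη⟩
  · exact IsCompact.of_isClosed_subset isCompact_Icc (isClosed_tsupport _) hts
  · exact hts.trans (Icc_subset_Ioo (neg_lt_neg hd.2) hd.2)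

/-- The lemma of du Bois-Reymond on `(-1, 1)`. -/
theorem exists_ae_eq_const {w : ℝ → ℝ} (hw : LocallyIntegrableOn w J)
    (h : ∀ φ : ℝ → ℝ, ContDiff ℝ ∞ φ → HasCompactSupport φ → tsupport φ ⊆ J →
      ∫ x in J, w x * deriv φ x = 0) :
    ∃ c : ℝ, ∀ᵐ x ∂(volume : Measure ℝ), x ∈ J → w x = c := by
  let f : ContDiffBump (0 : ℝ) := ⟨1 / 4, 1 / 2, by norm_num, by norm_num⟩
  set ψ : ℝ → ℝ := f.normed volume with hψ
  have hψs : ContDiff ℝ ∞ ψ := f.contDiff_normed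
  have hψc : HasCompactSupport ψ := f.hasCompactSupport_normed
  have hψt : tsupport ψ ⊆ J := by
    rw [hψ, f.tsupport_normed_eq, Real.closedBall_eq_Icc]
    refine Icc_subset_Ioo ?_ ?_ <;> norm_num [f]
  have hψi : ∫ x, ψ x = 1 := f.integral_normed
  have hψI : Integrable ψ := hψs.continuous.integrable_of_hasCompactSupport hψc
  refine ⟨∫ x, w x * ψ x, ?_⟩
  have key : ∀ᵐ x ∂(volume : Measure ℝ), x ∈ J → w x - (∫ x, w x * ψ x) = 0 := by
    refine isOpen_Ioo.ae_eq_zero_of_integral_contDiff_smul_eq_zero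
      (hw.sub (continuousOn_const.locallyIntegrableOn measurableSet_Ioo)) ?_
    intro φ hφ hc hs
    have hφI : Integrable φ := hφ.continuous.integrable_of_hasCompactSupport hc
    have hsub : tsupport (φ - (∫ t, φ t) • ψ) ⊆ J := by
      refine (tsupport_sub φ _).trans (union_subset hs ?_)
      exact (closure_mono (Function.support_const_smul_subset _ _)).trans hψt
    -- Subtracting `(∫ φ) ψ`, with `∫ ψ = 1`, gives mean zero, hence the derivative of an admissible
    -- test function.
    obtain ⟨Φ, hΦ, hΦc, hΦs, hΦd⟩ := exists_test_primitive (η := φ - (∫ t, φ t) • ψ)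
      (hφ.sub (hψs.const_smul (∫ t, φ t) :)) (hc.sub (hψc.smul_left (f := fun _ => ∫ t, φ t))) hsub (by
        simp only [Pi.sub_apply, Pi.smul_apply, smul_eq_mul]
        rw [integral_sub hφI (hψI.const_mul _), integral_const_mul, hψi]
        ring)
    have h1 := h Φ hΦ hΦc hΦs
    rw [hΦd] at h1
    have hwφ := integrable_mul_test hw hφ.continuous hc hs
    have hwψ := integrable_mul_test hw hψs.continuous hψc hψt
    have e : (fun x => w x * (φ - (∫ t, φ t) • ψ) x) =
        fun x => w x * φ x - (∫ t, φ t) * (w x * ψ x) := by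
      ext x
      simp only [Pi.sub_apply, Pi.smul_apply, smul_eq_mul]
      ring
    rw [setIntegral_J_eq_of_support (support_mul_test hsub), e,
      integral_sub hwφ (hwψ.const_mul _), integral_const_mul] at h1
    have e2 : (fun x => φ x • (w x - ∫ x, w x * ψ x)) =
        fun x => w x * φ x - (∫ x, w x * ψ x) * φ x := by
      ext x
      simp only [smul_eq_mul]
      ring
    rw [e2, integral_sub hwφ (hφI.const_mul _), integral_const_mul]
    linarith
  filter_upwards [key] with x hx hxJ
  linarith [hx hxJ]

theorem intervalIntegrable_of_locallyIntegrableOn {v : ℝ → ℝ} (hv : LocallyIntegrableOn v J)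
    {a b : ℝ} (ha : a ∈ J) (hb : b ∈ J) : IntervalIntegrable v volume a b := by
  refine IntegrableOn.intervalIntegrable
    (hv.integrableOn_compact_subset ?_ isCompact_uIcc)
  exact ordConnected_Ioo.uIcc_subset ha hb

theorem isPrimitiveOn_integral {v : ℝ → ℝ} (hv : LocallyIntegrableOn v J) (c : ℝ) {a b : ℝ}
    (ha : a ∈ J) (hb : b ∈ J) : IsPrimitiveOn (fun x => c + ∫ t in (0 : ℝ)..x, v t) v a b := by
  have h0 : (0 : ℝ) ∈ J := by norm_num
  refine ⟨intervalIntegrable_of_locallyIntegrableOn hv ha hb, fun x hx => ?_⟩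
  have hx' : x ∈ J := ordConnected_Ioo.uIcc_subset ha hb hx
  simp only
  rw [add_assoc, intervalIntegral.integral_add_adjacent_intervals
    (intervalIntegrable_of_locallyIntegrableOn hv h0 ha)
    (intervalIntegrable_of_locallyIntegrableOn hv ha hx')]

theorem continuousOn_of_isPrimitiveOn {k v : ℝ → ℝ}
    (hk : ∀ a ∈ J, ∀ b ∈ J, IsPrimitiveOn k v a b) : ContinuousOn k J := by
  intro x hx
  obtain ⟨a, ha1, ha2⟩ := exists_between hx.1
  obtain ⟨b, hb1, hb2⟩ := exists_between hx.2
  have h := (hk a ⟨ha1, ha2.trans hx.2⟩ b ⟨hx.1.trans hb1, hb2⟩).continuousOn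
  rw [uIcc_of_le (ha2.trans hb1).le] at h
  exact (h.continuousAt (Icc_mem_nhds ha2 hb1)).continuousWithinAt

theorem integral_primitive_mul_deriv {G v φ : ℝ → ℝ}
    (hG : ∀ a ∈ J, ∀ b ∈ J, IsPrimitiveOn G v a b) (hφ : ContDiff ℝ ∞ φ)
    (hc : HasCompactSupport φ) (hs : tsupport φ ⊆ J) :
    ∫ x in J, G x * deriv φ x = - ∫ x in J, v x * φ x := by
  obtain ⟨d, hd, hsd⟩ := exists_tsupport_subset_Ioo hc hs
  have hz : ∀ x, x ∉ Ioo (-d) d → φ x = 0 := fun x hx =>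
    image_eq_zero_of_notMem_tsupport fun h => hx (hsd h)
  have hdJ : d ∈ J := ⟨by linarith [hd.1], hd.2⟩
  have hdJ' : -d ∈ J := ⟨neg_lt_neg hd.2, by linarith [hd.1]⟩
  have hP := hG (-d) hdJ' d hdJ
  have hdc : Continuous (deriv φ) := hφ.continuous_deriv (by simp)
  have hφP : IsPrimitiveOn φ (deriv φ) (-d) d := isPrimitiveOn_of_hasDerivAt
    (fun x _ => (hφ.differentiable (by simp) x).hasDerivAt) hdc.continuousOn
  have h1 := hP.integral_by_parts hφP
  rw [intervalIntegral.integral_add (hP.1.mul_continuousOn hφ.continuous.continuousOn)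
    (hφP.1.continuousOn_mul hP.continuousOn), hz d (fun h => lt_irrefl _ h.2),
    hz (-d) (fun h => lt_irrefl _ h.1)] at h1
  have hts : tsupport (deriv φ) ⊆ Ioo (-d) d := tsupport_deriv_subset.trans hsd
  have hsup : ∀ (u χ : ℝ → ℝ), tsupport χ ⊆ Ioo (-d) d →
      ∫ x in J, u x * χ x = ∫ x in (-d)..d, u x * χ x := by
    intro u χ hχ
    have hsu : Function.support (fun x => u x * χ x) ⊆ Ioo (-d) d :=
      (Function.support_mul_subset_right _ _).trans ((subset_tsupport χ).trans hχ)
    rw [intervalIntegral.integral_eq_integral_of_support_subset (hsu.trans Ioo_subset_Ioc_self),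
      setIntegral_J_eq_of_support (hsu.trans (Ioo_subset_Ioo hdJ'.1.le hdJ.2.le))]
  rw [hsup _ _ hts, hsup _ _ hsd]
  linarith

theorem hasWeakDeriv_of_isPrimitiveOn {G v : ℝ → ℝ} (hv : LocallyIntegrableOn v J)
    (hG : ∀ a ∈ J, ∀ b ∈ J, IsPrimitiveOn G v a b) : HasWeakDeriv G v :=
  ⟨(continuousOn_of_isPrimitiveOn hG).locallyIntegrableOn measurableSet_Ioo, hv,
    fun _ hφ hc hs => integral_primitive_mul_deriv hG hφ hc hs⟩

/-- The primitive of `v` from `0` has the same weak derivative as `g`, so by du Bois-Reymond they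
differ by a constant almost everywhere. -/
theorem HasWeakDeriv.exists_isPrimitiveOn {g v : ℝ → ℝ} (h : HasWeakDeriv g v) :
    ∃ G : ℝ → ℝ, (∀ a ∈ J, ∀ b ∈ J, IsPrimitiveOn G v a b) ∧ g =ᵐ[volume.restrict J] G := by
  obtain ⟨hg, hv, hgv⟩ := h
  set G₀ : ℝ → ℝ := fun x => 0 + ∫ t in (0 : ℝ)..x, v t with hG₀
  have hP : ∀ a ∈ J, ∀ b ∈ J, IsPrimitiveOn G₀ v a b := fun a ha b hb =>
    isPrimitiveOn_integral hv 0 ha hb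
  have hG₀i : LocallyIntegrableOn G₀ J := (hasWeakDeriv_of_isPrimitiveOn hv hP).1
  obtain ⟨c, hc⟩ := exists_ae_eq_const (hg.sub hG₀i) (by
    intro φ hφ hφc hφs
    have hdc : Continuous (deriv φ) := hφ.continuous_deriv (by simp)
    have hds : tsupport (deriv φ) ⊆ J := tsupport_deriv_subset.trans hφs
    simp only [Pi.sub_apply, sub_mul]
    rw [integral_sub (integrable_mul_test hg hdc hφc.deriv hds).integrableOn
      (integrable_mul_test hG₀i hdc hφc.deriv hds).integrableOn, hgv φ hφ hφc hφs,
      integral_primitive_mul_deriv hP hφ hφc hφs]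
    ring)
  refine ⟨fun x => c + ∫ t in (0 : ℝ)..x, v t,
    fun a ha b hb => isPrimitiveOn_integral hv c ha hb, ?_⟩
  rw [Filter.EventuallyEq, ae_restrict_iff' measurableSet_Ioo]
  filter_upwards [hc] with x hx hxJ
  have := hx hxJ
  simp only [Pi.sub_apply, hG₀] at this
  linarith

/-! ### Growth at the endpoints -/

theorem neg_mem_J {a : ℝ} (ha : a ∈ J) : -a ∈ J := ⟨by linarith [ha.2], by linarith [ha.1]⟩

theorem abs_lt_one_of_mem_J {x : ℝ} (hx : x ∈ J) : |x| < 1 := abs_lt.2 hx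

theorem IsPrimitiveOn.comp_neg {k v : ℝ → ℝ} {a b : ℝ} (h : IsPrimitiveOn k v (-a) (-b)) :
    IsPrimitiveOn (fun x => k (-x)) (fun x => -v (-x)) a b := by
  refine ⟨?_, fun x hx => ?_⟩
  · have := ((IntervalIntegrable.iff_comp_neg (by simp)).1 h.1).neg
    rw [neg_neg, neg_neg] at this
    exact this
  · have hx' : -x ∈ uIcc (-a) (-b) := by
      rw [mem_uIcc] at hx ⊢
      rcases hx with hx | hx
      · right; constructor <;> linarith
      · left; constructor <;> linarith
    simp only
    rw [h.2 _ hx', intervalIntegral.integral_neg, intervalIntegral.integral_comp_neg,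
      intervalIntegral.integral_symm]

theorem isPrimitiveOn_neg_log_one_sub {x : ℝ} (hx : x ∈ Ico (0 : ℝ) 1) :
    IsPrimitiveOn (fun t => -log (1 - t)) (fun t => 1 / (1 - t)) 0 x := by
  have hs : ∀ t ∈ uIcc 0 x, 1 - t ≠ 0 := fun t ht => by
    rw [uIcc_of_le hx.1] at ht
    exact (sub_pos.2 (ht.2.trans_lt hx.2)).ne'
  refine isPrimitiveOn_of_hasDerivAt (fun t ht => ?_) (by fun_prop (disch := assumption))
  refine (((hasDerivAt_id' t).const_sub 1).log (hs t ht)).neg.congr_deriv ?_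
  ring

/-- Integrate `|v| ≤ 2(1-t)v² + 1/(8(1-t))`. Young's inequality allows any positive logarithmic
coefficient; `1/8` bounds `e^{2k}` by a multiple of `(1-|x|)^{-1/4}`, which is integrable. -/
theorem abs_sub_le_of_isPrimitiveOn {k v : ℝ → ℝ} (hk : ∀ a ∈ J, ∀ b ∈ J, IsPrimitiveOn k v a b)
    (hE : IntegrableOn (fun x => (1 - x ^ 2) * |v x| ^ 2) J) {x : ℝ} (hx : x ∈ Ico (0 : ℝ) 1) :
    |k x - k 0| ≤ 2 * (∫ t in J, (1 - t ^ 2) * |v t| ^ 2) - 1 / 8 * log (1 - x) := by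
  have hP := hk 0 (by norm_num) x ⟨by linarith [hx.1], hx.2⟩
  have hL := isPrimitiveOn_neg_log_one_sub hx
  have hsub : Icc 0 x ⊆ J := Icc_subset_Ioo (by norm_num) hx.2
  have hEi : IntervalIntegrable (fun x => (1 - x ^ 2) * |v x| ^ 2) volume 0 x :=
    (intervalIntegrable_iff_integrableOn_Icc_of_le hx.1).2 (hE.mono_set hsub)
  have e1 : k x - k 0 = ∫ t in (0 : ℝ)..x, v t := by
    rw [hP.2 x right_mem_uIcc]; ring
  have e2 := hL.2 x right_mem_uIcc
  simp only [sub_zero, log_one, neg_zero, zero_add] at e2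
  have h1 : ∫ t in (0 : ℝ)..x, |v t| ≤
      ∫ t in (0 : ℝ)..x, (2 * ((1 - t ^ 2) * |v t| ^ 2) + 1 / 8 * (1 / (1 - t))) := by
    refine intervalIntegral.integral_mono_on hx.1 hP.1.abs
      ((hEi.const_mul 2).add (hL.1.const_mul _)) fun t ht => ?_
    have ht1 : 0 < 1 - t := sub_pos.2 (ht.2.trans_lt hx.2)
    have h2 : (1 - t) * |v t| ^ 2 ≤ (1 - t ^ 2) * |v t| ^ 2 := by
      refine mul_le_mul_of_nonneg_right ?_ (by positivity)
      nlinarith [ht.1]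
    have h3 : 2 * ((1 - t) * |v t| ^ 2) + 1 / 8 * (1 / (1 - t)) - |v t|
        = (4 * (1 - t) * |v t| - 1) ^ 2 / (8 * (1 - t)) := by
      field_simp
      ring
    have h4 : 0 ≤ (4 * (1 - t) * |v t| - 1) ^ 2 / (8 * (1 - t)) := by positivity
    linarith
  rw [intervalIntegral.integral_add (hEi.const_mul 2) (hL.1.const_mul _),
    intervalIntegral.integral_const_mul, intervalIntegral.integral_const_mul, ← e2] at h1
  have h5 : ∫ t in (0 : ℝ)..x, (1 - t ^ 2) * |v t| ^ 2 ≤ ∫ t in J, (1 - t ^ 2) * |v t| ^ 2 := by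
    rw [intervalIntegral.integral_of_le hx.1]
    refine setIntegral_mono_set hE ?_ (Ioc_subset_Icc_self.trans hsub).eventuallyLE
    refine (ae_restrict_iff' measurableSet_Ioo).2 (ae_of_all _ fun t ht => ?_)
    have : 0 ≤ 1 - t ^ 2 := by nlinarith [ht.1, ht.2]
    exact mul_nonneg this (by positivity)
  have h6 := intervalIntegral.abs_integral_le_integral_abs (f := v) (μ := volume) hx.1
  rw [e1]
  linarith

theorem integrableOn_comp_neg_J {f : ℝ → ℝ} (hf : IntegrableOn f J) :
    IntegrableOn (fun x => f (-x)) J := by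
  have := hf.comp_neg
  rwa [show (-J : Set ℝ) = J by rw [neg_Ioo, neg_neg]] at this

/-- Functions of finite weighted energy grow at most logarithmically at the endpoints. -/
theorem exists_abs_le_log {k v : ℝ → ℝ} (hk : ∀ a ∈ J, ∀ b ∈ J, IsPrimitiveOn k v a b)
    (hE : IntegrableOn (fun x => (1 - x ^ 2) * |v x| ^ 2) J) :
    ∃ C, ∀ x ∈ J, |k x| ≤ C - 1 / 8 * log (1 - |x|) := by
  have hE' : IntegrableOn (fun x => (1 - x ^ 2) * |-v (-x)| ^ 2) J := by
    simpa using integrableOn_comp_neg_J hE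
  refine ⟨max (2 * (∫ t in J, (1 - t ^ 2) * |v t| ^ 2))
    (2 * (∫ t in J, (1 - t ^ 2) * |-v (-t)| ^ 2)) + |k 0|, fun x hx => ?_⟩
  have h3 := abs_sub_abs_le_abs_sub (k x) (k 0)
  rcases le_total 0 x with h | h
  · have h1 := abs_sub_le_of_isPrimitiveOn hk hE ⟨h, hx.2⟩
    have h2 := le_max_left (2 * (∫ t in J, (1 - t ^ 2) * |v t| ^ 2))
      (2 * (∫ t in J, (1 - t ^ 2) * |-v (-t)| ^ 2))
    rw [abs_of_nonneg h]
    linarith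
  · have h1 := abs_sub_le_of_isPrimitiveOn
      (fun a ha b hb => (hk _ (neg_mem_J ha) _ (neg_mem_J hb)).comp_neg) hE'
      (x := -x) ⟨by linarith, by linarith [hx.1]⟩
    have h2 := le_max_right (2 * (∫ t in J, (1 - t ^ 2) * |v t| ^ 2))
      (2 * (∫ t in J, (1 - t ^ 2) * |-v (-t)| ^ 2))
    simp only [neg_neg, neg_zero] at h1
    rw [abs_of_nonpos h]
    linarith

theorem exp_two_mul_le {k C x : ℝ} (hx : |x| < 1) (h : |k| ≤ C - 1 / 8 * log (1 - |x|)) :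
    exp (2 * k) ≤ exp (2 * C) * (1 - |x|) ^ (-(1 / 4) : ℝ) := by
  rw [rpow_def_of_pos (sub_pos.2 hx), ← exp_add, exp_le_exp]
  linarith [le_abs_self k]

theorem integrableOn_exp_of_abs_le_log {k : ℝ → ℝ} {C : ℝ} (hkc : ContinuousOn k J)
    (hC : ∀ x ∈ J, |k x| ≤ C - 1 / 8 * log (1 - |x|)) :
    IntegrableOn (fun x => exp (2 * k x)) J := by
  have h1 : IntervalIntegrable (fun x : ℝ => (1 - x) ^ (-(1 / 4) : ℝ)) volume (-1) 1 := by
    have := (intervalIntegral.intervalIntegrable_rpow' (a := 2) (b := 0)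
      (show (-1 : ℝ) < -(1 / 4) by norm_num)).comp_sub_left 1
    norm_num at this ⊢
    exact this
  have h1' : IntegrableOn (fun x : ℝ => (1 - x) ^ (-(1 / 4) : ℝ)) J :=
    ((intervalIntegrable_iff_integrableOn_Icc_of_le (by norm_num)).1 h1).mono_set Ioo_subset_Icc_self
  have h2' := integrableOn_comp_neg_J h1'
  have hc : ContinuousOn (fun x => exp (2 * k x)) J := by fun_prop
  refine Integrable.mono' ((h1'.add h2').const_mul (exp (2 * C)))
    (hc.aestronglyMeasurable measurableSet_Ioo) ?_
  refine (ae_restrict_iff' measurableSet_Ioo).2 (ae_of_all _ fun x hx => ?_)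
  rw [norm_of_nonneg (exp_pos _).le]
  refine (exp_two_mul_le (abs_lt_one_of_mem_J hx) (hC x hx)).trans ?_
  refine mul_le_mul_of_nonneg_left ?_ (exp_pos _).le
  have hp : 0 ≤ (1 - x) ^ (-(1 / 4) : ℝ) := rpow_nonneg (by linarith [hx.2]) _
  have hn : 0 ≤ (1 - -x) ^ (-(1 / 4) : ℝ) := rpow_nonneg (by linarith [hx.1]) _
  simp only [Pi.add_apply]
  rcases abs_cases x with ⟨h, _⟩ | ⟨h, _⟩ <;> rw [h] <;> linarith

/-- The defect `1 - y` of the distribution function decays like a power at the endpoint. -/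
theorem one_sub_le_rpow {k y : ℝ → ℝ} {C : ℝ} (hC : ∀ x ∈ J, |k x| ≤ C - 1 / 8 * log (1 - |x|))
    (hy : ∀ x ∈ J, HasDerivAt y (exp (2 * k x)) x) (h1 : Tendsto y (𝓝[<] 1) (𝓝 1))
    {x : ℝ} (hx : x ∈ Ico (0 : ℝ) 1) :
    1 - y x ≤ 4 / 3 * exp (2 * C) * (1 - x) ^ (3 / 4 : ℝ) := by
  set K := 4 / 3 * exp (2 * C) with hK
  have hsub : Ico (0 : ℝ) 1 ⊆ J := fun t ht => ⟨by linarith [ht.1], ht.2⟩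
  have hd : ∀ t ∈ Ico (0 : ℝ) 1, HasDerivAt (fun t => y t + K * (1 - t) ^ (3 / 4 : ℝ))
      (exp (2 * k t) - exp (2 * C) * (1 - t) ^ (-(1 / 4) : ℝ)) t := fun t ht => by
    have := (hy t (hsub ht)).add ((((hasDerivAt_id' t).const_sub 1).rpow_const
      (p := 3 / 4) (Or.inl (sub_pos.2 ht.2).ne')).const_mul K)
    refine this.congr_deriv ?_
    rw [hK]
    norm_num
    ring
  -- The factor `4/3` in `K` cancels the exponent `3/4`, so the derivative is `e^{2k}` minus its
  -- upper bound; the limit at `1` then gives the estimate.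
  have hanti : AntitoneOn (fun t => y t + K * (1 - t) ^ (3 / 4 : ℝ)) (Ico 0 1) := by
    refine antitoneOn_of_deriv_nonpos (convex_Ico _ _)
      (fun t ht => (hd t ht).continuousAt.continuousWithinAt)
      (fun t ht => (hd t (interior_subset ht)).differentiableAt.differentiableWithinAt)
      fun t ht => ?_
    have ht' := interior_subset ht
    rw [(hd t ht').deriv]
    have h := exp_two_mul_le (abs_lt_one_of_mem_J (hsub ht')) (hC t (hsub ht'))
    rw [abs_of_nonneg ht'.1] at h
    linarith
  have hl : Tendsto (fun t => y t + K * (1 - t) ^ (3 / 4 : ℝ)) (𝓝[<] 1)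
      (𝓝 (1 + K * (1 - 1) ^ (3 / 4 : ℝ))) := by
    have hx : Tendsto (fun x : ℝ => 1 - x) (𝓝[<] 1) (𝓝 (1 - 1)) :=
      (tendsto_id.mono_left nhdsWithin_le_nhds).const_sub 1
    exact h1.add ((hx.rpow_const (Or.inr (by norm_num))).const_mul K)
  rw [sub_self, zero_rpow (by norm_num), mul_zero, add_zero] at hl
  have := le_of_tendsto hl (by
    filter_upwards [Ioo_mem_nhdsLT hx.2] with t ht
    exact hanti hx ⟨hx.1.trans ht.1.le, ht.2⟩ ht.1.le)
  linarith

theorem tendsto_rpow_mul_log_one_sub {r : ℝ} (hr : 0 < r) :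
    Tendsto (fun x : ℝ => (1 - x) ^ r * log (1 - x)) (𝓝[<] 1) (𝓝 0) := by
  have h : Tendsto (fun x : ℝ => 1 - x) (𝓝[<] 1) (𝓝[>] 0) := by
    refine tendsto_nhdsWithin_iff.2 ⟨?_, ?_⟩
    · have : Tendsto (fun x : ℝ => 1 - x) (𝓝[<] 1) (𝓝 (1 - 1)) :=
        (tendsto_id.mono_left nhdsWithin_le_nhds).const_sub 1
      simpa using this
    · filter_upwards [self_mem_nhdsWithin] with x hx
      exact sub_pos.2 (mem_Iio.1 hx)
  have := (tendsto_log_mul_rpow_nhdsGT_zero hr).comp h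
  refine this.congr fun x => ?_
  simp only [Function.comp_apply]
  ring

theorem tendsto_one_sub_mul_log {k y : ℝ → ℝ} {C : ℝ}
    (hC : ∀ x ∈ J, |k x| ≤ C - 1 / 8 * log (1 - |x|))
    (hy : ∀ x ∈ J, HasDerivAt y (exp (2 * k x)) x) (h1 : Tendsto y (𝓝[<] 1) (𝓝 1))
    (hle : ∀ x ∈ J, y x ≤ 1) :
    Tendsto (fun x => (1 - y x) * log (1 - x)) (𝓝[<] 1) (𝓝 0) := by
  have h := ((tendsto_rpow_mul_log_one_sub (r := 3 / 4) (by norm_num)).norm).const_mul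
    (4 / 3 * exp (2 * C))
  rw [norm_zero, mul_zero] at h
  refine squeeze_zero_norm' ?_ h
  filter_upwards [Ioo_mem_nhdsLT (show (0 : ℝ) < 1 by norm_num)] with x hx
  rw [norm_mul, norm_mul, ← mul_assoc, norm_of_nonneg (rpow_nonneg (by linarith [hx.2]) _),
    norm_of_nonneg (by linarith [hle x ⟨by linarith [hx.1], hx.2⟩])]
  exact mul_le_mul_of_nonneg_right (one_sub_le_rpow hC hy h1 ⟨hx.1.le, hx.2⟩) (norm_nonneg _)

/-- Here `|x - y| ≤ (1-x) + (1-y)` decays like a power of `1-x`, while `k` grows at most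
logarithmically. -/
theorem tendsto_mul_id_sub {k y : ℝ → ℝ} {C : ℝ}
    (hC : ∀ x ∈ J, |k x| ≤ C - 1 / 8 * log (1 - |x|))
    (hy : ∀ x ∈ J, HasDerivAt y (exp (2 * k x)) x) (h1 : Tendsto y (𝓝[<] 1) (𝓝 1))
    (hle : ∀ x ∈ J, y x ≤ 1) :
    Tendsto (fun x => k x * (x - y x)) (𝓝[<] 1) (𝓝 0) := by
  have hx0 : Tendsto (fun x : ℝ => 1 - x) (𝓝[<] 1) (𝓝 0) := by
    have : Tendsto (fun x : ℝ => 1 - x) (𝓝[<] 1) (𝓝 (1 - 1)) :=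
      (tendsto_id.mono_left nhdsWithin_le_nhds).const_sub 1
    simpa using this
  have ha := tendsto_one_sub_mul_log hC hy h1 hle
  have hb := tendsto_rpow_mul_log_one_sub (r := 1) (by norm_num)
  simp only [rpow_one] at hb
  have hd := ((hx0.add (show Tendsto (fun x => 1 - y x) (𝓝[<] 1) (𝓝 0) by
    simpa using h1.const_sub 1)).const_mul C).sub ((hb.add ha).const_mul (1 / 8))
  simp only [add_zero, mul_zero, sub_zero] at hd
  refine squeeze_zero_norm' ?_ hd
  filter_upwards [Ioo_mem_nhdsLT (show (0 : ℝ) < 1 by norm_num)] with x hx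
  have hxJ : x ∈ J := ⟨by linarith [hx.1], hx.2⟩
  have h2 := hC x hxJ
  rw [abs_of_pos hx.1] at h2
  have h3 : |x - y x| ≤ (1 - x) + (1 - y x) := by
    have := hle x hxJ
    rw [abs_le]
    constructor <;> linarith [hx.2]
  rw [norm_mul, norm_eq_abs, norm_eq_abs]
  have := mul_le_mul h2 h3 (abs_nonneg _) ((abs_nonneg _).trans h2)
  linarith

/-! ### The sharp inequality -/

/-- The one-sided bound is applied to `(k, y, m)` and to the reflected data `k(-x)`, `-y(-x)`, `-m`.
The lower bounds on the two sides of `m` sum to zero. -/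
theorem integral_nonneg_of_median {m C : ℝ} {k v y : ℝ → ℝ} (hm : m ∈ J)
    (hk : ∀ a ∈ J, ∀ b ∈ J, IsPrimitiveOn k v a b)
    (hC : ∀ x ∈ J, |k x| ≤ C - 1 / 8 * log (1 - |x|))
    (hy : ∀ x ∈ J, HasDerivAt y (exp (2 * k x)) x) (hym : y m = 0)
    (hr : Tendsto y (𝓝[<] 1) (𝓝 1)) (hl : Tendsto y (𝓝[>] (-1)) (𝓝 (-1)))
    (hle : ∀ x ∈ J, |y x| ≤ 1)
    (hint : IntegrableOn (fun x => 1 / 2 * ((1 - x ^ 2) * |v x| ^ 2) + 2 * k x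
      + (log (1 + m) - log (1 - m)) * (x * exp (2 * k x))) J) :
    0 ≤ ∫ x in J, (1 / 2 * ((1 - x ^ 2) * |v x| ^ 2) + 2 * k x
        + (log (1 + m) - log (1 - m)) * (x * exp (2 * k x))) := by
  set F := fun x => 1 / 2 * ((1 - x ^ 2) * |v x| ^ 2) + 2 * k x
    + (log (1 + m) - log (1 - m)) * (x * exp (2 * k x)) with hF
  have hle1 : ∀ x ∈ J, y x ≤ 1 := fun x hx => (abs_le.1 (hle x hx)).2
  have h1 := integral_ge_of_hasDerivAt hm hk hy hym hr (tendsto_one_sub_mul_log hC hy hr hle1)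
    (tendsto_mul_id_sub hC hy hr hle1) (hint.mono_set (Ioo_subset_Ioo_left hm.1.le))
  have hC' : ∀ x ∈ J, |k (-x)| ≤ C - 1 / 8 * log (1 - |x|) := fun x hx => by
    have := hC (-x) (neg_mem_J hx)
    rwa [abs_neg] at this
  have hy' : ∀ x ∈ J, HasDerivAt (fun x => -y (-x)) (exp (2 * k (-x))) x := fun x hx => by
    have := ((hy (-x) (neg_mem_J hx)).comp x (hasDerivAt_neg x)).neg
    refine this.congr_deriv ?_
    ring
  have hr' : Tendsto (fun x => -y (-x)) (𝓝[<] 1) (𝓝 1) := by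
    have h : Tendsto (fun x : ℝ => -x) (𝓝[<] 1) (𝓝[>] (-1)) := tendsto_neg_nhdsLT
    simpa using (hl.comp h).neg
  have hle' : ∀ x ∈ J, -y (-x) ≤ 1 := fun x hx => by
    linarith [(abs_le.1 (hle (-x) (neg_mem_J hx))).1]
  have hFn : (fun x => 1 / 2 * ((1 - x ^ 2) * |-v (-x)| ^ 2) + 2 * k (-x)
      + (log (1 + -m) - log (1 - -m)) * (x * exp (2 * k (-x)))) = fun x => F (-x) := by
    ext x
    simp only [hF, abs_neg]
    rw [sub_neg_eq_add, ← sub_eq_add_neg]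
    ring
  have h2 := integral_ge_of_hasDerivAt (neg_mem_J hm)
    (fun a ha b hb => (hk _ (neg_mem_J ha) _ (neg_mem_J hb)).comp_neg) hy'
    (by simp only [neg_neg, hym, neg_zero]) hr' (tendsto_one_sub_mul_log hC' hy' hr' hle')
    (tendsto_mul_id_sub hC' hy' hr' hle')
    (by rw [hFn]; exact (integrableOn_comp_neg_J hint).mono_set
          (Ioo_subset_Ioo_left (neg_mem_J hm).1.le))
  simp only [hFn, neg_neg] at h2
  rw [sub_neg_eq_add, ← sub_eq_add_neg] at h2
  have hII : IntervalIntegrable F volume (-1) 1 :=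
    (intervalIntegrable_iff_integrableOn_Ioo_of_le (by norm_num)).2 hint
  have hI : ∀ a ∈ Icc (-1 : ℝ) 1, ∀ b ∈ Icc (-1 : ℝ) 1, IntervalIntegrable F volume a b :=
    fun a ha b hb => hII.mono_set (by
      rw [uIcc_of_le (show (-1 : ℝ) ≤ 1 by norm_num)]
      exact ordConnected_Icc.uIcc_subset ha hb)
  have hm' : m ∈ Icc (-1 : ℝ) 1 := Ioo_subset_Icc_self hm
  rw [← integral_Ioc_eq_integral_Ioo, ← intervalIntegral.integral_of_le (neg_mem_J hm).2.le,
    intervalIntegral.integral_comp_neg, neg_neg] at h2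
  rw [← integral_Ioc_eq_integral_Ioo, ← intervalIntegral.integral_of_le hm.2.le] at h1
  rw [← integral_Ioc_eq_integral_Ioo, ← intervalIntegral.integral_of_le (by norm_num),
    ← intervalIntegral.integral_add_adjacent_intervals (hI (-1) (by norm_num) m hm')
      (hI m hm' 1 (by norm_num))]
  linarith

theorem exists_distribution {u : ℝ → ℝ} (huc : ContinuousOn u J) (hu : ∀ x ∈ J, 0 < u x)
    (hui : IntegrableOn u J) (h2 : ∫ x in J, u x = 2) :
    ∃ y : ℝ → ℝ, (∀ x ∈ J, HasDerivAt y (u x) x) ∧ Tendsto y (𝓝[<] 1) (𝓝 1) ∧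
      Tendsto y (𝓝[>] (-1)) (𝓝 (-1)) ∧ (∀ x ∈ J, |y x| ≤ 1) ∧ ∃ m ∈ J, y m = 0 := by
  have hle : (-1 : ℝ) ≤ 1 := by norm_num
  have hlt : (-1 : ℝ) < 1 := by norm_num
  have hII : IntervalIntegrable u volume (-1) 1 :=
    (intervalIntegrable_iff_integrableOn_Ioo_of_le hle).2 hui
  set y : ℝ → ℝ := fun x => -1 + ∫ t in (-1 : ℝ)..x, u t with hy
  have hc : ContinuousOn y (Icc (-1) 1) := by
    have := intervalIntegral.continuousOn_primitive_interval' hII left_mem_uIcc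
    rw [uIcc_of_le hle] at this
    exact continuousOn_const.add this
  have hy0 : y (-1) = -1 := by simp [hy]
  have hy1 : y 1 = 1 := by
    simp only [hy]
    rw [intervalIntegral.integral_of_le hle, integral_Ioc_eq_integral_Ioo, h2]
    norm_num
  have hd : ∀ x ∈ J, HasDerivAt y (u x) x := fun x hx => by
    have hn : J ∈ 𝓝 x := isOpen_Ioo.mem_nhds hx
    refine (intervalIntegral.integral_hasDerivAt_right ?_ ?_ (huc.continuousAt hn)).const_add (-1)
    · refine hII.mono_set ?_
      rw [uIcc_of_le hle, uIcc_of_le hx.1.le]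
      exact Icc_subset_Icc_right hx.2.le
    · exact huc.stronglyMeasurableAtFilter isOpen_Ioo x hx
  have hmono : MonotoneOn y (Icc (-1) 1) := by
    refine monotoneOn_of_deriv_nonneg (convex_Icc _ _) hc ?_ ?_ <;> rw [interior_Icc]
    · exact fun x hx => (hd x hx).differentiableAt.differentiableWithinAt
    · intro x hx
      rw [(hd x hx).deriv]
      exact (hu x hx).le
  refine ⟨y, hd, ?_, ?_, fun x hx => ?_, ?_⟩
  · have := (hc 1 (right_mem_Icc.2 hle)).tendsto
    rw [hy1] at this
    exact this.mono_left (nhdsWithin_le_of_mem (Icc_mem_nhdsLT hlt))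
  · have := (hc (-1) (left_mem_Icc.2 hle)).tendsto
    rw [hy0] at this
    exact this.mono_left (nhdsWithin_le_of_mem (Icc_mem_nhdsGT hlt))
  · have hx' := Ioo_subset_Icc_self hx
    have ha := hmono (left_mem_Icc.2 hle) hx' hx'.1
    have hb := hmono hx' (right_mem_Icc.2 hle) hx'.2
    rw [hy0] at ha
    rw [hy1] at hb
    exact abs_le.2 ⟨ha, hb⟩
  · have h0 : (0 : ℝ) ∈ Ioo (y (-1)) (y 1) := by rw [hy0, hy1]; norm_num
    obtain ⟨m, hm, hm0⟩ := intermediate_value_Ioo hle hc h0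
    exact ⟨m, hm, hm0⟩

/-- Elements of `H¹(-1, 1)` have locally absolutely continuous representatives of at most
logarithmic growth. -/
theorem exists_representative {g : ℝ → ℝ} (hg : g ∈ H1) :
    ∃ (G : ℝ → ℝ) (C : ℝ), (∀ a ∈ J, ∀ b ∈ J, IsPrimitiveOn G (weakDeriv g) a b) ∧
      g =ᵐ[volume.restrict J] G ∧ ∀ x ∈ J, |G x| ≤ C - 1 / 8 * log (1 - |x|) := by
  obtain ⟨-, hw, hE⟩ := hg
  obtain ⟨G, hG, hgG⟩ := hw.exists_isPrimitiveOn
  obtain ⟨C, hC⟩ := exists_abs_le_log hG hE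
  exact ⟨G, C, hG, hgG, hC⟩

theorem integrableOn_exp {g : ℝ → ℝ} (hg : g ∈ H1) :
    IntegrableOn (fun x => exp (2 * g x)) J := by
  obtain ⟨G, C, hG, hgG, hC⟩ := exists_representative hg
  have h := integrableOn_exp_of_abs_le_log (continuousOn_of_isPrimitiveOn hG) hC
  refine Integrable.congr h ?_
  filter_upwards [hgG] with x hx
  rw [hx]

theorem functional_half_nonneg {g : ℝ → ℝ} (hg : g ∈ constraintSet) :
    0 ≤ functional (1 / 2) g := by
  obtain ⟨hg1, hgc⟩ := hg
  obtain ⟨G, C, hG, hgG, hC⟩ := exists_representative hg1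
  have hGc := continuousOn_of_isPrimitiveOn hG
  have hexp : IntegrableOn (fun x => exp (2 * G x)) J := integrableOn_exp_of_abs_le_log hGc hC
  have e1 : ∫ x in J, g x = ∫ x in J, G x := integral_congr_ae hgG
  have e2 : ∫ x in J, exp (2 * g x) = ∫ x in J, exp (2 * G x) :=
    integral_congr_ae (by filter_upwards [hgG] with x hx; rw [hx])
  have e3 : ∫ x in J, exp (2 * G x) * x = 0 := by
    rw [← hgc]
    exact integral_congr_ae (by filter_upwards [hgG] with x hx; rw [hx])
  have hgi : IntegrableOn G J :=
    ((hg1.1.integrable (by norm_num)).congr hgG)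
  have hexpx : IntegrableOn (fun x => exp (2 * G x) * x) J := by
    refine Integrable.mono' hexp ?_ ?_
    · exact hexp.aestronglyMeasurable.mul continuous_id.aestronglyMeasurable
    · refine (ae_restrict_iff' measurableSet_Ioo).2 (ae_of_all _ fun x hx => ?_)
      rw [norm_mul, norm_of_nonneg (exp_pos _).le, norm_eq_abs]
      exact mul_le_of_le_one_right (exp_pos _).le (abs_lt_one_of_mem_J hx).le
  set A := 1 / 2 * ∫ x in J, exp (2 * G x) with hA
  have hApos : 0 < A := by
    have : 0 < ∫ x in J, exp (2 * G x) := by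
      refine (setIntegral_pos_iff_support_of_nonneg_ae (ae_of_all _ fun x => (exp_pos _).le)
        hexp).2 ?_
      rw [show Function.support (fun x => exp (2 * G x)) = univ from
        Function.support_eq_univ fun x => (exp_pos _).ne', univ_inter, Real.volume_Ioo]
      norm_num
    positivity
  -- This shift gives `e^{2k}` total mass `2`, the length of the interval, so its distribution
  -- function runs from `-1` to `1`.
  set k : ℝ → ℝ := fun x => G x - 1 / 2 * log A with hk
  have hkP : ∀ a ∈ J, ∀ b ∈ J, IsPrimitiveOn k (weakDeriv g) a b := fun a ha b hb => by
    refine ⟨(hG a ha b hb).1, fun x hx => ?_⟩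
    simp only [hk]
    rw [(hG a ha b hb).2 x hx]
    ring
  have hkC : ∀ x ∈ J, |k x| ≤ (C + |1 / 2 * log A|) - 1 / 8 * log (1 - |x|) := fun x hx => by
    have := abs_sub (G x) (1 / 2 * log A)
    linarith [hC x hx]
  have hke : ∀ x, exp (2 * k x) = A⁻¹ * exp (2 * G x) := fun x => by
    simp only [hk]
    rw [show 2 * (G x - 1 / 2 * log A) = -log A + 2 * G x by ring, exp_add, exp_neg,
      exp_log hApos]
  have hkc : ContinuousOn k J := continuousOn_of_isPrimitiveOn hkP
  have hki : IntegrableOn k J := hgi.sub (integrableOn_const (by simp))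
  have hkei : IntegrableOn (fun x => exp (2 * k x)) J :=
    integrableOn_exp_of_abs_le_log hkc hkC
  have hk2 : ∫ x in J, exp (2 * k x) = 2 := by
    simp only [hke]
    rw [integral_const_mul, show ∫ x in J, exp (2 * G x) = 2 * A by rw [hA]; ring]
    field_simp
  have hkx : ∀ x, x * exp (2 * k x) = A⁻¹ * (exp (2 * G x) * x) := fun x => by rw [hke]; ring
  have hkxi : IntegrableOn (fun x => x * exp (2 * k x)) J := by
    simp only [hkx]
    exact hexpx.const_mul _
  have hkx0 : ∫ x in J, x * exp (2 * k x) = 0 := by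
    simp only [hkx]
    rw [integral_const_mul, e3, mul_zero]
  have hik : ∫ x in J, k x = (∫ x in J, G x) - log A := by
    simp only [hk]
    rw [integral_sub hgi (integrableOn_const (by simp)), setIntegral_const]
    simp only [measureReal_def, Real.volume_Ioo, smul_eq_mul]
    norm_num
    ring
  obtain ⟨y, hy, hr, hl, hle, m, hm, hym⟩ :=
    exists_distribution (by fun_prop) (fun x _ => exp_pos _) hkei hk2
  have hi1 := hg1.2.2.const_mul (1 / 2)
  have hi2 := hki.const_mul 2
  -- The multiplier term depends on `m` but integrates to zero by the constraint.
  have hi3 := hkxi.const_mul (log (1 + m) - log (1 - m))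
  have h := integral_nonneg_of_median hm hkP hkC hy hym hr hl hle ((hi1.add hi2).add hi3)
  have e4 := integral_add (hi1.add hi2) hi3
  simp only [Pi.add_apply] at e4
  rw [e4, integral_add hi1 hi2, integral_const_mul, integral_const_mul, integral_const_mul, hkx0,
    hik] at h
  unfold functional
  rw [e1, e2]
  linarith

theorem energy_nonneg (g : ℝ → ℝ) : 0 ≤ ∫ x in J, (1 - x ^ 2) * |weakDeriv g x| ^ 2 := by
  refine setIntegral_nonneg measurableSet_Ioo fun x hx => ?_
  have : 0 ≤ 1 - x ^ 2 := by nlinarith [hx.1, hx.2]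
  positivity

theorem functional_mono (g : ℝ → ℝ) {α β : ℝ} (h : α ≤ β) : functional α g ≤ functional β g := by
  unfold functional
  have := mul_le_mul_of_nonneg_right h (energy_nonneg g)
  linarith

/-! ### Test functions concentrating at both endpoints -/

theorem mem_H1_of_hasDerivAt {g v : ℝ → ℝ} (hg : ∀ x ∈ Icc (-1 : ℝ) 1, HasDerivAt g (v x) x)
    (hv : ContinuousOn v (Icc (-1) 1)) :
    g ∈ H1 ∧ ∫ x in J, (1 - x ^ 2) * |weakDeriv g x| ^ 2 = ∫ x in J, (1 - x ^ 2) * |v x| ^ 2 := by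
  have hsub : J ⊆ Icc (-1 : ℝ) 1 := Ioo_subset_Icc_self
  have hgc : ContinuousOn g (Icc (-1) 1) := fun x hx => (hg x hx).continuousAt.continuousWithinAt
  have hvl : LocallyIntegrableOn v J := (hv.mono hsub).locallyIntegrableOn measurableSet_Ioo
  have hw : HasWeakDeriv g v := hasWeakDeriv_of_isPrimitiveOn hvl fun a ha b hb => by
    have hab : uIcc a b ⊆ Icc (-1 : ℝ) 1 := ordConnected_Icc.uIcc_subset (hsub ha) (hsub hb)
    exact isPrimitiveOn_of_hasDerivAt (fun x hx => hg x (hab hx)) (hv.mono hab)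
  have hae := hw.weakDeriv.ae_eq hw
  have hae' : (fun x => (1 - x ^ 2) * |weakDeriv g x| ^ 2) =ᵐ[volume.restrict J]
      fun x => (1 - x ^ 2) * |v x| ^ 2 := by
    filter_upwards [hae] with x hx
    rw [hx]
  refine ⟨⟨?_, hw.weakDeriv, ?_⟩, integral_congr_ae hae'⟩
  · obtain ⟨K, hK⟩ := isCompact_Icc.exists_bound_of_continuousOn hgc
    refine MemLp.of_bound ((hgc.mono hsub).aestronglyMeasurable measurableSet_Ioo) K ?_
    exact (ae_restrict_iff' measurableSet_Ioo).2 (ae_of_all _ fun x hx => hK x (hsub hx))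
  · refine Integrable.congr ?_ hae'.symm
    have hc : ContinuousOn (fun x => (1 - x ^ 2) * |v x| ^ 2) (Icc (-1) 1) := by fun_prop
    exact (hc.integrableOn_Icc).mono_set hsub

theorem zero_mem_constraintSet : (0 : ℝ → ℝ) ∈ constraintSet := by
  refine ⟨(mem_H1_of_hasDerivAt (v := fun _ => 0) (fun x _ => hasDerivAt_const x 0)
    continuousOn_const).1, ?_⟩
  simp only [Pi.zero_apply, mul_zero, exp_zero, one_mul]
  rw [← integral_Ioc_eq_integral_Ioo, ← intervalIntegral.integral_of_le (by norm_num), integral_id]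
  norm_num

theorem functional_zero (α : ℝ) : functional α 0 = 0 := by
  have h := (mem_H1_of_hasDerivAt (g := 0) (v := fun _ => 0) (fun x _ => hasDerivAt_const x 0)
    continuousOn_const).2
  unfold functional
  rw [h]
  norm_num [measureReal_def, Real.volume_Ioo]

/-- An even function concentrating at `±1` as `b → 1`. -/
noncomputable def bump (b x : ℝ) : ℝ := -log (1 - b ^ 2 * x ^ 2)

variable {b : ℝ}

theorem one_sub_mul_pos_of_mem_Icc (hb : b ∈ Ioo (0 : ℝ) 1) {x : ℝ} (hx : x ∈ Icc (-1 : ℝ) 1) :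
    0 < 1 - b * x ∧ 0 < 1 + b * x := by
  obtain ⟨hb0, hb1⟩ := hb
  obtain ⟨hx0, hx1⟩ := hx
  constructor <;> nlinarith

theorem bump_arg_pos (hb : b ∈ Ioo (0 : ℝ) 1) {x : ℝ} (hx : x ∈ Icc (-1 : ℝ) 1) :
    0 < 1 - b ^ 2 * x ^ 2 := by
  have h := one_sub_mul_pos_of_mem_Icc hb hx
  have := mul_pos h.1 h.2
  nlinarith

theorem hasDerivAt_bump (hb : b ∈ Ioo (0 : ℝ) 1) {x : ℝ} (hx : x ∈ Icc (-1 : ℝ) 1) :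
    HasDerivAt (bump b) (2 * b ^ 2 * x / (1 - b ^ 2 * x ^ 2)) x := by
  have h := (((((hasDerivAt_id' x).pow 2).const_mul (b ^ 2)).const_sub 1).log
    (bump_arg_pos hb hx).ne').neg
  refine h.congr_deriv ?_
  simp only [Pi.pow_apply]
  ring

theorem bump_mem_H1 (hb : b ∈ Ioo (0 : ℝ) 1) : bump b ∈ H1 ∧
    ∫ x in J, (1 - x ^ 2) * |weakDeriv (bump b) x| ^ 2 =
      ∫ x in J, (1 - x ^ 2) * |2 * b ^ 2 * x / (1 - b ^ 2 * x ^ 2)| ^ 2 :=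
  mem_H1_of_hasDerivAt (fun _ hx => hasDerivAt_bump hb hx) (by
    have : ∀ x ∈ Icc (-1 : ℝ) 1, 1 - b ^ 2 * x ^ 2 ≠ 0 := fun x hx => (bump_arg_pos hb hx).ne'
    fun_prop (disch := assumption))

theorem bump_mem_constraintSet (hb : b ∈ Ioo (0 : ℝ) 1) : bump b ∈ constraintSet := by
  refine ⟨(bump_mem_H1 hb).1, ?_⟩
  rw [← integral_Ioc_eq_integral_Ioo, ← intervalIntegral.integral_of_le (by norm_num)]
  have h := intervalIntegral.integral_comp_neg (a := -1) (b := 1)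
    (f := fun x => exp (2 * bump b x) * x)
  simp only [bump, neg_sq, mul_neg, intervalIntegral.integral_neg, neg_neg] at h ⊢
  linarith

/-- Since `(1-x²) b²x² ≤ 1 - b²x²`, the integrand is at most `4b²/(1-b²x²)`, which has an explicit
logarithmic primitive. -/
theorem energy_bump_le (hb : b ∈ Ioo (0 : ℝ) 1) :
    ∫ x in J, (1 - x ^ 2) * |weakDeriv (bump b) x| ^ 2 ≤ 4 * (log 2 - log (1 - b)) := by
  obtain ⟨hb0, hb1⟩ := hb
  have hb' : b ∈ Ioo (0 : ℝ) 1 := ⟨hb0, hb1⟩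
  have hle : (-1 : ℝ) ≤ 1 := by norm_num
  have hne : ∀ x ∈ Icc (-1 : ℝ) 1, 1 - b ^ 2 * x ^ 2 ≠ 0 := fun x hx => (bump_arg_pos hb' hx).ne'
  have hP : IsPrimitiveOn (fun x => 2 * b * (log (1 + b * x) - log (1 - b * x)))
      (fun x => 4 * b ^ 2 / (1 - b ^ 2 * x ^ 2)) (-1) 1 := by
    refine isPrimitiveOn_of_hasDerivAt (fun x hx => ?_) ?_ <;> rw [uIcc_of_le hle] at *
    · obtain ⟨h1, h2⟩ := one_sub_mul_pos_of_mem_Icc hb' hx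
      have h3 := bump_arg_pos hb' hx
      have i := (hasDerivAt_id' x).const_mul b
      refine ((((i.const_add 1).log h2.ne').sub ((i.const_sub 1).log h1.ne')).const_mul
        (2 * b)).congr_deriv ?_
      rw [show 1 - b ^ 2 * x ^ 2 = (1 - b * x) * (1 + b * x) by ring]
      field_simp
      ring
    · fun_prop (disch := assumption)
  rw [(bump_mem_H1 hb').2, ← integral_Ioc_eq_integral_Ioo, ← intervalIntegral.integral_of_le hle]
  have h1 : ∫ x in (-1 : ℝ)..1, (1 - x ^ 2) * |2 * b ^ 2 * x / (1 - b ^ 2 * x ^ 2)| ^ 2 ≤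
      ∫ x in (-1 : ℝ)..1, 4 * b ^ 2 / (1 - b ^ 2 * x ^ 2) := by
    refine intervalIntegral.integral_mono_on hle ?_ hP.1 fun x hx => ?_
    · refine ContinuousOn.intervalIntegrable ?_
      rw [uIcc_of_le hle]
      fun_prop (disch := assumption)
    · have h3 := bump_arg_pos hb' hx
      have hx2 : x ^ 2 ≤ 1 := by nlinarith [hx.1, hx.2]
      have hbb : b ^ 2 ≤ 1 := by nlinarith
      rw [sq_abs, div_pow, mul_div_assoc', div_le_div_iff₀ (by positivity) h3]
      have h4 : (1 - x ^ 2) * (b ^ 2 * x ^ 2) ≤ (1 - b ^ 2 * x ^ 2) * 1 := by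
        refine mul_le_mul ?_ (by nlinarith) (by positivity) h3.le
        nlinarith [sq_nonneg x]
      have h5 := mul_le_mul_of_nonneg_left h4
        (show 0 ≤ 4 * b ^ 2 * (1 - b ^ 2 * x ^ 2) by positivity)
      linarith
  have h2 := hP.2 1 right_mem_uIcc
  simp only [mul_one, mul_neg, sub_neg_eq_add, ← sub_eq_add_neg] at h2
  have h3 : log (1 + b) ≤ log 2 := log_le_log (by linarith) (by linarith)
  have h4 : log (1 - b) ≤ 0 := log_nonpos (by linarith) (by linarith)
  have h5 : 0 ≤ log 2 := log_nonneg (by norm_num)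
  have h6 : b * (log (1 + b) - log (1 - b)) ≤ 1 * (log 2 - log (1 - b)) :=
    mul_le_mul hb1.le (by linarith) (by linarith [log_nonneg (show 1 ≤ 1 + b by linarith)])
      (by norm_num)
  linarith

theorem integral_bump_le (hb : b ∈ Ioo (0 : ℝ) 1) : ∫ x in J, bump b x ≤ 4 := by
  have hle : (-1 : ℝ) ≤ 1 := by norm_num
  have hb0 := hb.1
  have hP : IsPrimitiveOn
      (fun x => ((1 - b * x) * log (1 - b * x) - (1 + b * x) * log (1 + b * x)) / b + 2 * x)
      (bump b) (-1) 1 := by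
    refine isPrimitiveOn_of_hasDerivAt (fun x hx => ?_) fun x hx => ?_ <;> rw [uIcc_of_le hle] at *
    · obtain ⟨h1, h2⟩ := one_sub_mul_pos_of_mem_Icc hb hx
      have i := (hasDerivAt_id' x).const_mul b
      have d := ((((i.const_sub 1).mul ((i.const_sub 1).log h1.ne')).sub
        ((i.const_add 1).mul ((i.const_add 1).log h2.ne'))).div_const b).add
        ((hasDerivAt_id' x).const_mul 2)
      refine d.congr_deriv ?_
      rw [bump, show 1 - b ^ 2 * x ^ 2 = (1 - b * x) * (1 + b * x) by ring, log_mul h1.ne' h2.ne']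
      field_simp
      ring
    · exact (hasDerivAt_bump hb hx).continuousAt.continuousWithinAt
  rw [← integral_Ioc_eq_integral_Ioo, ← intervalIntegral.integral_of_le hle]
  have h2 := hP.2 1 right_mem_uIcc
  simp only [mul_one, mul_neg, sub_neg_eq_add, ← sub_eq_add_neg] at h2
  have h3 : (1 - b) * log (1 - b) ≤ 0 :=
    mul_nonpos_of_nonneg_of_nonpos (by linarith [hb.2])
      (log_nonpos (by linarith [hb.2]) (by linarith))
  have h4 : 0 ≤ (1 + b) * log (1 + b) :=
    mul_nonneg (by linarith) (log_nonneg (by linarith))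
  have h5 : ((1 - b) * log (1 - b) - (1 + b) * log (1 + b)) / b ≤ 0 :=
    div_nonpos_of_nonpos_of_nonneg (by linarith) hb0.le
  have h6 : ((1 + b) * log (1 + b) - (1 - b) * log (1 - b)) / b
      = -(((1 - b) * log (1 - b) - (1 + b) * log (1 + b)) / b) := by ring
  rw [h6] at h2
  linarith

/-- On `(b, 1)` one has `1 - b²x² ≤ 4(1-b)`, so `e^{2g} ≥ 1/(16(1-b)²)` on a set of length `1-b`;
halving gives `1/(32(1-b))`. -/
theorem log_integral_exp_bump_ge (hb : b ∈ Ioo (0 : ℝ) 1) :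
    -log 32 - log (1 - b) ≤ log (1 / 2 * ∫ x in J, exp (2 * bump b x)) := by
  have hb0 := hb.1
  have hb1 : 0 < 1 - b := sub_pos.2 hb.2
  have hint := integrableOn_exp (bump_mem_H1 hb).1
  have hsub : Ioo b 1 ⊆ J := Ioo_subset_Ioo_left (by linarith)
  have h1 : ∫ x in Ioo b 1, exp (2 * bump b x) ≤ ∫ x in J, exp (2 * bump b x) :=
    setIntegral_mono_set hint (ae_of_all _ fun x => (exp_pos _).le) hsub.eventuallyLE
  have h2 : ∫ x in Ioo b 1, (1 / (4 * (1 - b)) ^ 2 : ℝ) ≤ ∫ x in Ioo b 1, exp (2 * bump b x) := by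
    refine setIntegral_mono_on (integrableOn_const (by simp)) (hint.mono_set hsub)
      measurableSet_Ioo fun x hx => ?_
    have h3 := bump_arg_pos hb (Ioo_subset_Icc_self (hsub hx))
    have h4 : exp (2 * bump b x) = 1 / (1 - b ^ 2 * x ^ 2) ^ 2 := by
      rw [bump, show 2 * -log (1 - b ^ 2 * x ^ 2) = -(log (1 - b ^ 2 * x ^ 2)
        + log (1 - b ^ 2 * x ^ 2)) by ring, exp_neg, exp_add, exp_log h3, one_div, sq (1 - b ^ 2 * x ^ 2)]
    rw [h4]
    refine one_div_le_one_div_of_le (by positivity) (pow_le_pow_left₀ h3.le ?_ 2)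
    have h5 : b * b ≤ b * x := mul_le_mul_of_nonneg_left hx.1.le hb0.le
    have h6 : b * x ≤ 1 := by nlinarith [hx.2, hb.2]
    nlinarith [mul_nonneg (sub_nonneg.2 h6) (mul_pos hb0 (hb0.trans hx.1)).le]
  rw [setIntegral_const] at h2
  simp only [measureReal_def, Real.volume_Ioo, smul_eq_mul, ENNReal.toReal_ofReal hb1.le] at h2
  have e : (1 - b) * (1 / (4 * (1 - b)) ^ 2) = 2 * (1 / (32 * (1 - b))) := by
    field_simp
    norm_num
  rw [e] at h2
  have h3 : -log 32 - log (1 - b) = log (1 / (32 * (1 - b))) := by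
    rw [one_div, log_inv, log_mul (by norm_num) hb1.ne']
    ring
  rw [h3]
  exact log_le_log (by positivity) (by linarith)

theorem functional_bump_le {α : ℝ} (hα : 0 ≤ α) (hb : b ∈ Ioo (0 : ℝ) 1) :
    functional α (bump b) ≤ (1 - 2 * α) * log (1 - b) + (2 * α * log 2 + 4 + log 32) := by
  have h1 := mul_le_mul_of_nonneg_left (energy_bump_le hb) (show 0 ≤ α / 2 by positivity)
  have h2 := integral_bump_le hb
  have h3 := log_integral_exp_bump_ge hb
  unfold functional
  linarith

theorem exists_functional_lt {α : ℝ} (hα : α < 1 / 2) (M : ℝ) :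
    ∃ g ∈ constraintSet, functional α g < M := by
  -- The bump estimate needs a nonnegative parameter; negative `α` is covered by monotonicity.
  set β := max α 0 with hβ
  have hβ0 : 0 ≤ β := le_max_right _ _
  have hβ1 : 0 < 1 - 2 * β := by
    have : β < 1 / 2 := max_lt hα (by norm_num)
    linarith
  set K := 2 * β * log 2 + 4 + log 32 with hK
  -- With `b = 1 - e^{-T}`, `log(1-b) = -T`, and this `T` brings the upper bound to at most `M - 1`;
  -- `T ≥ 1` ensures `b > 0`.
  set T := max 1 ((K - M + 1) / (1 - 2 * β)) with hT
  have hT1 : 1 ≤ T := le_max_left _ _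
  have hT2 : (K - M + 1) / (1 - 2 * β) ≤ T := le_max_right _ _
  have hb : 1 - exp (-T) ∈ Ioo (0 : ℝ) 1 :=
    ⟨by have : exp (-T) < 1 := exp_lt_one_iff.2 (by linarith)
        linarith, by linarith [exp_pos (-T)]⟩
  refine ⟨bump (1 - exp (-T)), bump_mem_constraintSet hb, ?_⟩
  have h1 := functional_mono (bump (1 - exp (-T))) (le_max_left α 0)
  have h2 := functional_bump_le hβ0 hb
  rw [sub_sub_cancel, log_exp] at h2
  rw [div_le_iff₀ hβ1] at hT2
  linarith

end LogSobolevLine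

/-! ### The infimum on both sides of the threshold -/

theorem mainTheorem11 :
    (∀ g ∈ LogSobolevLine.H1,
      IntegrableOn (fun x => Real.exp (2 * g x)) (Ioo (-1 : ℝ) 1)) ∧
    (∀ α : ℝ, 1 / 2 ≤ α →
      (⨅ g ∈ LogSobolevLine.constraintSet, (LogSobolevLine.functional α g : EReal)) = 0) ∧
    (∀ α : ℝ, α < 1 / 2 →
      (⨅ g ∈ LogSobolevLine.constraintSet, (LogSobolevLine.functional α g : EReal)) = ⊥) := by
  refine ⟨fun g hg => LogSobolevLine.integrableOn_exp hg, fun α hα => le_antisymm ?_ ?_,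
    fun α hα => ?_⟩
  · refine (iInf₂_le 0 LogSobolevLine.zero_mem_constraintSet).trans ?_
    rw [LogSobolevLine.functional_zero, EReal.coe_zero]
  · refine le_iInf₂ fun g hg => ?_
    exact_mod_cast (LogSobolevLine.functional_half_nonneg hg).trans
      (LogSobolevLine.functional_mono g hα)
  · refine (EReal.eq_bot_iff_forall_lt _).2 fun M => ?_
    obtain ⟨g, hg, hgM⟩ := LogSobolevLine.exists_functional_lt hα M
    exact (iInf₂_le g hg).trans_lt (EReal.coe_lt_coe hgM)
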